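/- Let $n\ge 2$, let $(W,\omega)$ be a compact symplectic manifold with boundary, of dimension $2n$ (smooth up to the boundary), and let $V$ be a closed $(2n-1)$-dimensional manifold identified with $\partial W$ by a smooth embedding $V\to W$ with image $\partial W$. Let $\xi$ be a co-oriented contact structure on $V$, i.e. a co-oriented hyperplane field that is the kernel of a smooth $1$-form $\alpha$, positive on positively transverse vectors, with $d\alpha|_\xi$ nondegenerate; all such $\alpha$ are called contact forms of $\xi$. Orient $V$ by the volume forms $\alpha\wedge(d\alpha)^{n-1}$, and let $CS_\xi$ be the set of all $d\alpha|_\xi$, where $\alpha$ runs through the contact forms of $\xi$. Say that $(W,\omega)$ is a weak filling of $(V,\xi)$ if $V=\partial W$ as oriented manifolds ($W$ being oriented by $\omega^n$, and $\partial W$ by the outward normal first convention), $\omega_\xi:=\omega|_\xi$ is symplectic (nondegenerate on $\xi$ at every point), and every element of $\omega_\xi+CS_\xi$ is symplectic on $\xi$. For a smooth almost complex structure $J$ on $W$, say that $(V,\xi)$ is the tamed pseudoconvex boundary of $(W,J)$ if $V=\partial W$ as oriented manifolds ($W$ being oriented by $J$), $\xi=TV\cap J\,TV$, there is a symplectic form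 $\omega'$ on $W$ taming $J$ (i.e. $\omega'(v,Jv)>0$ for all $v\neq 0$), and $d\lambda(v,Jv)>0$ for every contact form $\lambda$ of $\xi$ and every nonzero $v\in\xi$. Then $(W,\omega)$ is a weak filling of $(V,\xi)$ if and only if there is a smooth almost complex structure $J$ on $W$ that is tamed by $\omega$ and such that $(V,\xi)$ is the tamed pseudoconvex boundary of $(W,J)$. -/

import Mathlib

open Set Module
open scoped Manifold ContDiff Topology

noncomputable section

section DifferentialForms

/-- A (not necessarily smooth) differential `m`-form on a manifold `M`, possibly with boundary. -/
abbrev DForm {E : Type*} [NormedAddCommGroup E] [NormedSpace ℝ E] {H : Type*} [TopologicalSpace H]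
    (I : ModelWithCorners ℝ E H) (M : Type*) [TopologicalSpace M] [ChartedSpace H M] (m : ℕ) :
    Type _ :=
  ∀ x : M, TangentSpace I x [⋀^Fin m]→L[ℝ] ℝ

variable {E : Type*} [NormedAddCommGroup E] [NormedSpace ℝ E] {H : Type*} [TopologicalSpace H]
  {I : ModelWithCorners ℝ E H} {M : Type*} [TopologicalSpace M] [ChartedSpace H M] {m : ℕ}

/-- The coordinate expression of a form in the chart at `x₀`: its pull-back by the inverse of the
chart, an `m`-form on (the image of the chart in) the model space. -/
def DForm.inChart (Ω : DForm I M m) (x₀ : M) (y : E) : E [⋀^Fin m]→L[ℝ] ℝ :=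
  (Ω ((extChartAt I x₀).symm y)).compContinuousLinearMap
    (mfderivWithin 𝓘(ℝ, E) I (extChartAt I x₀).symm (range I) y)

/-- A form is smooth (up to the boundary) if all its coordinate expressions are smooth. -/
def DForm.IsSmooth (Ω : DForm I M m) : Prop :=
  ∀ x₀ : M, ContDiffOn ℝ ∞ (Ω.inChart x₀) (extChartAt I x₀).target

/-- The exterior derivative of a form, computed at each point in the chart at that point. -/
def DForm.d (Ω : DForm I M m) : DForm I M (m + 1) := fun x =>
  (extDerivWithin (Ω.inChart x) (range I) (extChartAt I x x)).compContinuousLinearMap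
    (mfderiv I 𝓘(ℝ, E) (extChartAt I x) x)

/-- The pull-back of a form by a map between manifolds. -/
def DForm.pullback {E' : Type*} [NormedAddCommGroup E'] [NormedSpace ℝ E'] {H' : Type*}
    [TopologicalSpace H'] {I' : ModelWithCorners ℝ E' H'} {N : Type*} [TopologicalSpace N]
    [ChartedSpace H' N] (ι : N → M) (Ω : DForm I M m) : DForm I' N m := fun x =>
  (Ω (ι x)).compContinuousLinearMap (mfderiv I' I ι x)

/-- The restriction of the 2-form `B` to the subspace `S` is nondegenerate. -/
def NondegenerateOn {T : Type*} [AddCommGroup T] [Module ℝ T] [TopologicalSpace T]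
    (B : T [⋀^Fin 2]→L[ℝ] ℝ) (S : Submodule ℝ T) : Prop :=
  ∀ v ∈ S, (∀ w ∈ S, B ![v, w] = 0) → v = 0

/-- Symplectic forms: smooth closed nondegenerate 2-forms. -/
structure IsSymplecticForm (Ω : DForm I M 2) : Prop where
  smooth : Ω.IsSmooth
  closed : ∀ x, Ω.d x = 0
  nondegenerate : ∀ x, NondegenerateOn (Ω x) ⊤

/-- Smooth almost complex structures: smooth sections `J` of the endomorphism bundle of the tangent
bundle with `J² = -1`. -/
structure IsAlmostComplexStructure [IsManifold I ∞ M]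
    (J : ∀ x : M, TangentSpace I x →L[ℝ] TangentSpace I x) : Prop where
  smooth : ContMDiff I (I.prod 𝓘(ℝ, E →L[ℝ] E)) ∞
    (fun x => Bundle.TotalSpace.mk' (E →L[ℝ] E)
      (E := fun x : M => TangentSpace I x →L[ℝ] TangentSpace I x) x (J x))
  sq_eq_neg : ∀ (x : M) (v : TangentSpace I x), J x (J x v) = -v

/-- `J` is tamed by `Ω`: `Ω(v, J v) > 0` for all nonzero tangent vectors `v`. -/
def IsTamedBy (J : ∀ x : M, TangentSpace I x →L[ℝ] TangentSpace I x) (Ω : DForm I M 2) : Prop :=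
  ∀ (x : M) (v : TangentSpace I x), v ≠ 0 → 0 < Ω x ![v, J x v]

end DifferentialForms

section VolumeForms

variable {T : Type*} [AddCommGroup T] [Module ℝ T] [TopologicalSpace T]

/-- A positive multiple of the value `B^(k+1) (e₀, …, e_{2k+1})` of the top exterior power of the
2-form `B` on a space of dimension `2k+2`: the antisymmetrization of
`B(e₀, e₁) B(e₂, e₃) ⋯ B(e_{2k}, e_{2k+1})`. -/
def symplecticVolume (k : ℕ) (B : T [⋀^Fin 2]→L[ℝ] ℝ) (e : Fin (2 * k + 2) → T) : ℝ :=
  ∑ σ : Equiv.Perm (Fin (2 * k + 2)), ((Equiv.Perm.sign σ : ℤ) : ℝ) *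
    ∏ i : Fin (k + 1),
      B ![e (σ ⟨2 * (i : ℕ), by omega⟩), e (σ ⟨2 * (i : ℕ) + 1, by omega⟩)]

/-- A positive multiple of the value `(α ∧ B^k) (e₀, …, e_{2k})` of the exterior product of the
1-form `α` and the `k`-th exterior power of the 2-form `B` on a space of dimension `2k+1`: the
antisymmetrization of `α(e₀) B(e₁, e₂) ⋯ B(e_{2k-1}, e_{2k})`. -/
def contactVolume (k : ℕ) (α : T [⋀^Fin 1]→L[ℝ] ℝ) (B : T [⋀^Fin 2]→L[ℝ] ℝ)
    (e : Fin (2 * k + 1) → T) : ℝ :=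
  ∑ σ : Equiv.Perm (Fin (2 * k + 1)), ((Equiv.Perm.sign σ : ℤ) : ℝ) *
    (α ![e (σ 0)] * ∏ i : Fin k,
      B ![e (σ ⟨2 * (i : ℕ) + 1, by omega⟩), e (σ ⟨2 * (i : ℕ) + 2, by omega⟩)])

/-- Positively oriented frames of a complex vector space of complex dimension `k+1`, with complex
structure `J`: the complex orientation is the one given by the real bases
`v₀, J v₀, …, v_k, J v_k`. -/
def IsComplexPositive (k : ℕ) (J : T →L[ℝ] T) (e : Fin (2 * k + 2) → T) : Prop :=
  ∃ b : Basis (Fin (2 * k + 2)) ℝ T,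
    (∀ i : Fin (k + 1),
      b ⟨2 * (i : ℕ) + 1, by omega⟩ = J (b ⟨2 * (i : ℕ), by omega⟩)) ∧ 0 < b.det e

end VolumeForms

section Contact

/-- A co-oriented contact structure on a `(2k+1)`-dimensional manifold `V`: a hyperplane field with
a side of positively transverse vectors, which is the kernel of a global smooth
1-form `α`, positive on the positively transverse vectors, with `dα` nondegenerate on the kernel. -/
structure ContactStructure (k : ℕ) (V : Type*) [TopologicalSpace V]
    [ChartedSpace (EuclideanSpace ℝ (Fin (2 * k + 1))) V] where
  /-- the hyperplanes -/
  plane : ∀ x : V, Submodule ℝ (TangentSpace (𝓡 (2 * k + 1)) x)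
  /-- the positively transverse vectors -/
  posSide : ∀ x : V, Set (TangentSpace (𝓡 (2 * k + 1)) x)
  exists_form : ∃ α : DForm (𝓡 (2 * k + 1)) V 1, α.IsSmooth ∧
    (∀ x, α x ≠ 0) ∧
    (∀ x v, v ∈ plane x ↔ α x ![v] = 0) ∧
    (∀ x v, v ∈ posSide x ↔ 0 < α x ![v]) ∧
    ∀ x, NondegenerateOn (α.d x) (plane x)

variable {k : ℕ} {V : Type*} [TopologicalSpace V]
  [ChartedSpace (EuclideanSpace ℝ (Fin (2 * k + 1))) V]

/-- The smooth 1-forms defining the co-oriented hyperplane field `ξ`, i.e. its contact forms. -/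
structure ContactStructure.IsContactForm (ξ : ContactStructure k V)
    (α : DForm (𝓡 (2 * k + 1)) V 1) : Prop where
  smooth : α.IsSmooth
  mem_plane_iff : ∀ x v, v ∈ ξ.plane x ↔ α x ![v] = 0
  mem_posSide_iff : ∀ x v, v ∈ ξ.posSide x ↔ 0 < α x ![v]

/-- Positively oriented frames of `T_x V` for the orientation of `V` defined by the co-oriented
contact structure `ξ`, that is, by the volume form `α ∧ (dα)^k` for contact forms `α` of `ξ`. -/
def ContactStructure.IsPositiveFrame (ξ : ContactStructure k V) (x : V)
    (e : Fin (2 * k + 1) → TangentSpace (𝓡 (2 * k + 1)) x) : Prop :=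
  ∀ α, ξ.IsContactForm α → 0 < contactVolume k (α x) (α.d x) e

end Contact

section Boundary

variable {k : ℕ} {V : Type*} [TopologicalSpace V]
  [ChartedSpace (EuclideanSpace ℝ (Fin (2 * k + 1))) V]
  {W : Type*} [TopologicalSpace W] [ChartedSpace (EuclideanHalfSpace (2 * k + 2)) W]

/-- `ι : V → W` identifies `V` with the boundary of `W`: it is a smooth embedding with image
`∂W`. -/
structure IsBoundaryIdentification (ι : V → W) : Prop where
  isSmoothEmbedding : Manifold.IsSmoothEmbedding (𝓡 (2 * k + 1)) (𝓡∂ (2 * k + 2)) ∞ ι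
  range_eq : range ι = (𝓡∂ (2 * k + 2)).boundary W

/-- Outward pointing tangent vectors at a boundary point `p` of `W`. The charts take values in the
half space where the coordinate of index `0` is nonnegative. -/
def IsOutward (p : W) (ν : TangentSpace (𝓡∂ (2 * k + 2)) p) : Prop :=
  let u : EuclideanSpace ℝ (Fin (2 * k + 2)) :=
    mfderiv (𝓡∂ (2 * k + 2)) 𝓘(ℝ, EuclideanSpace ℝ (Fin (2 * k + 2)))
      (extChartAt (𝓡∂ (2 * k + 2)) p) p ν
  u 0 < 0

/-- `V = ∂W` as oriented manifolds, where `V` is oriented by `ξ`, the orientation of `W` is given by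
its positive frames `posW`, and the boundary is oriented by the outward normal first convention. -/
def IsOrientedBoundary (ι : V → W) (ξ : ContactStructure k V)
    (posW : ∀ p : W, (Fin (2 * k + 2) → TangentSpace (𝓡∂ (2 * k + 2)) p) → Prop) : Prop :=
  ∀ (x : V) (ν : TangentSpace (𝓡∂ (2 * k + 2)) (ι x)), IsOutward (ι x) ν →
    ∀ e : Fin (2 * k + 1) → TangentSpace (𝓡 (2 * k + 1)) x,
      ξ.IsPositiveFrame x e ↔
        posW (ι x) (Fin.cons ν fun i => mfderiv (𝓡 (2 * k + 1)) (𝓡∂ (2 * k + 2)) ι x (e i))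

/-- `(W, Ω)` is a weak filling of `(V, ξ)`, with `V` identified with `∂W` by `ι`: the orientations
match, the restriction `Ω_ξ` is symplectic on `ξ`, and so is every element `Ω_ξ + dα|ξ` of
`Ω_ξ + CS_ξ`, where `CS_ξ` is the set of all `dα|ξ` for contact forms `α` of `ξ`. -/
structure IsWeakFilling (ι : V → W) (Ω : DForm (𝓡∂ (2 * k + 2)) W 2)
    (ξ : ContactStructure k V) : Prop where
  oriented : IsOrientedBoundary ι ξ fun p e => 0 < symplecticVolume k (Ω p) e
  nondegenerate : ∀ x, NondegenerateOn
    (DForm.pullback (I' := 𝓡 (2 * k + 1)) ι Ω x) (ξ.plane x)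
  nondegenerate_add : ∀ α, ξ.IsContactForm α → ∀ x, NondegenerateOn
    (DForm.pullback (I' := 𝓡 (2 * k + 1)) ι Ω x + α.d x) (ξ.plane x)

/-- `(V, ξ)` is the tamed pseudoconvex boundary of `(W, J)`, with `V` identified with `∂W` by `ι`:
the orientations match, where `W` carries the complex orientation; `ξ = TV ∩ J TV`;
`W` admits a symplectic form taming `J`; and `V` is `J`-convex, i.e. `dλ(v, J v) > 0` for every
contact form `λ` of `ξ` and every nonzero `v ∈ ξ`. In the last clause `w` is the vector tangent to
`V` that is `J v`. -/
structure IsTamedPseudoconvexBoundary (ι : V → W)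
    (J : ∀ p : W, TangentSpace (𝓡∂ (2 * k + 2)) p →L[ℝ] TangentSpace (𝓡∂ (2 * k + 2)) p)
    (ξ : ContactStructure k V) : Prop where
  oriented : IsOrientedBoundary ι ξ fun p e => IsComplexPositive k (J p) e
  complex_tangencies : ∀ x : V,
    (ξ.plane x).map (mfderiv (𝓡 (2 * k + 1)) (𝓡∂ (2 * k + 2)) ι x).toLinearMap =
      (mfderiv (𝓡 (2 * k + 1)) (𝓡∂ (2 * k + 2)) ι x).toLinearMap.range ⊓
        (mfderiv (𝓡 (2 * k + 1)) (𝓡∂ (2 * k + 2)) ι x).toLinearMap.range.map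
          (J (ι x)).toLinearMap
  tamed : ∃ Ω' : DForm (𝓡∂ (2 * k + 2)) W 2, IsSymplecticForm Ω' ∧ IsTamedBy J Ω'
  convex : ∀ l, ξ.IsContactForm l → ∀ x, ∀ v ∈ ξ.plane x, v ≠ 0 →
    ∃ w ∈ ξ.plane x,
      mfderiv (𝓡 (2 * k + 1)) (𝓡∂ (2 * k + 2)) ι x w =
        J (ι x) (mfderiv (𝓡 (2 * k + 1)) (𝓡∂ (2 * k + 2)) ι x v) ∧
      0 < l.d x ![v, w]

end Boundary

end

/-! The equation `J² = -1` is not a convex condition, but tameness is. At a point `p` of `W`,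
consider the endomorphisms `K` of the tangent space with `ω(v, K v) > 0` for `v ≠ 0` which, if `p`
lies on `V`, also map `ξ` to itself with `dα(v, K v) > 0` for nonzero `v ∈ ξ`. They form a convex
set, so a partition of unity glues local smooth fields of such `K` into a global one. The equation
is restored afterwards, one operator at a time.

This is done by `rotAvg`, the average of `K` over the Möbius maps `X ↦ (cos θ X + sin θ)(cos θ - sin
θ X)⁻¹`. They act like `tan a ↦ tan (a + θ)`, and the addition formula for the tangent shows that
the average squares to `-1` (`rotAvg_mul_self`). Tameness excludes real eigenvalues, so the maps are
defined at `K`. Each rotated operator is tamed by the same alternating forms and keeps the same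
invariant subspaces (`rotAvg_tame`, `rotAvg_apply_mem`). The average depends smoothly on `K` and
commutes with conjugation.

The weak filling condition yields the local `K` on `V`. Since `tα` is a contact form for `t > 0`,
`ω_ξ + t dα` is nondegenerate for all `t ≥ 0`. If no `K` on `ξ` were tamed by both `B₀ = ω_ξ` and
`B₁ = dα`, Gordan's alternative would give positive semidefinite `P`, `Q`, not both zero, with `B₀(P
m, ·) + B₁(Q m, ·) = 0` for all `m`. A maximum of the quotient of their quadratic forms gives `m`
with `Q m = c P m`, `P m ≠ 0`, `c ≥ 0`, unless some `m` has `P m = 0 ≠ Q m`; then `B₀ + c B₁`,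
respectively `B₁`, is degenerate (`exists_tame_pair`). The `ω`-complement of `ξ` is treated
separately, and the result is extended smoothly to nearby points.

Only one `α` is needed: contact forms differ by positive factors `f`, and `d(fα) = f dα` on `ξ`.
Conversely, if `J` is given and `0 ≠ v ∈ ξ`, then `J v` pairs positively with `v` under both `ω` and
`dα`, so no sum degenerates. The orientations agree because the 2-forms taming `J` form a convex set
of nondegenerate forms. -/

noncomputable section

/-! ### Averages over the Möbius maps fixing `i` and `-i` -/

section CayleyAverage

variable {A : Type*} [NormedRing A] [NormedAlgebra ℝ A]

/-- The denominators of the rotations `X ↦ (cos θ X + sin θ) (cos θ - sin θ X)⁻¹`. -/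
def rotDen (X : A) (θ : ℝ) : A := Real.cos θ • (1 : A) - Real.sin θ • X

/-- The numerators of the rotations `X ↦ (cos θ X + sin θ) (cos θ - sin θ X)⁻¹`. -/
def rotNum (X : A) (θ : ℝ) : A := Real.cos θ • X + Real.sin θ • (1 : A)

/-- The orbit of `X` under the rotations `X ↦ (cos θ X + sin θ) (cos θ - sin θ X)⁻¹`, which are the
Möbius transformations fixing `i` and `-i`. -/
def rot (X : A) (θ : ℝ) : A := rotNum X θ * Ring.inverse (rotDen X θ)

/-- The elements all of whose rotations are defined: those without real spectrum. -/
def IsRotatable (X : A) : Prop := ∀ θ, IsUnit (rotDen X θ)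

/-- The average of `X` over the group of Möbius transformations fixing `i` and `-i`. -/
def rotAvg (X : A) : A := (1 / Real.pi) • ∫ θ in (0 : ℝ)..Real.pi, rot X θ

lemma continuous_rotDen (X : A) : Continuous (rotDen X) := by
  unfold rotDen; fun_prop

lemma continuous_rotNum (X : A) : Continuous (rotNum X) := by
  unfold rotNum; fun_prop

lemma commute_rotDen_rotNum (X : A) (θ φ : ℝ) : Commute (rotDen X θ) (rotNum X φ) := by
  simp only [Commute, SemiconjBy, rotDen, rotNum, sub_mul, mul_add, mul_sub, add_mul,
    smul_mul_assoc, mul_smul_comm, one_mul, mul_one, smul_smul, smul_sub, smul_add]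
  module

lemma rot_mul_rotDen {X : A} (hX : IsRotatable X) (θ : ℝ) : rot X θ * rotDen X θ = rotNum X θ := by
  rw [rot, mul_assoc, Ring.inverse_mul_cancel _ (hX θ), mul_one]

lemma rot_add_pi {X : A} (hX : IsRotatable X) (θ : ℝ) : rot X (θ + Real.pi) = rot X θ := by
  have h1 : rotDen X (θ + Real.pi) = - rotDen X θ := by
    simp only [rotDen, Real.cos_add_pi, Real.sin_add_pi]; module
  have h2 : rotNum X (θ + Real.pi) = - rotNum X θ := by
    simp only [rotNum, Real.cos_add_pi, Real.sin_add_pi]; module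
  have h := rot_mul_rotDen hX (θ + Real.pi)
  rw [h1, h2, mul_neg, neg_inj, ← rot_mul_rotDen hX θ] at h
  exact (hX θ).mul_left_injective h

lemma rotDen_mul_rot {X : A} (hX : IsRotatable X) (θ : ℝ) : rotDen X θ * rot X θ = rotNum X θ := by
  rw [rot, ← mul_assoc, (commute_rotDen_rotNum X θ θ).eq, mul_assoc,
    Ring.mul_inverse_cancel _ (hX θ), mul_one]

/-- The subtraction formula `tan φ (1 + tan a tan (a + φ)) = tan (a + φ) - tan a`, cleared of
denominators; the rotation by `θ` sends `tan a` to `tan (a + θ)`. -/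
lemma rotNum_rotDen_identity (X : A) (θ φ : ℝ) :
    Real.sin φ • (rotNum X θ * rotNum X (θ + φ)) =
      Real.cos φ • (rotDen X θ * rotNum X (θ + φ) - rotNum X θ * rotDen X (θ + φ)) -
        Real.sin φ • (rotDen X θ * rotDen X (θ + φ)) := by
  have e1 : Real.cos (θ + φ) * Real.cos θ + Real.sin (θ + φ) * Real.sin θ = Real.cos φ := by
    rw [← Real.cos_sub]; congr 1; ring
  have e2 : Real.sin (θ + φ) * Real.cos θ - Real.cos (θ + φ) * Real.sin θ = Real.sin φ := by
    rw [← Real.sin_sub]; congr 1; ring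
  rw [← e1, ← e2]
  simp only [rotDen, rotNum, sub_mul, mul_add, mul_sub, add_mul,
    smul_mul_assoc, mul_smul_comm, one_mul, mul_one, smul_smul, smul_sub, smul_add]
  generalize Real.cos (θ + φ) = a
  generalize Real.sin (θ + φ) = b
  generalize Real.cos θ = c
  generalize Real.sin θ = d
  module

lemma rot_mul_rot {X : A} (hX : IsRotatable X) (θ φ : ℝ) :
    Real.sin φ • (rot X θ * rot X (θ + φ)) =
      Real.cos φ • (rot X (θ + φ) - rot X θ) - Real.sin φ • (1 : A) := by
  have h := rotNum_rotDen_identity X θ φ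
  rw [← (hX θ).mul_right_inj, ← (hX (θ + φ)).mul_left_inj]
  have e1 : rotDen X θ * (Real.sin φ • (rot X θ * rot X (θ + φ))) * rotDen X (θ + φ) =
      Real.sin φ • (rotNum X θ * rotNum X (θ + φ)) := by
    rw [mul_smul_comm, smul_mul_assoc, ← mul_assoc, rotDen_mul_rot hX, mul_assoc,
      rot_mul_rotDen hX]
  rw [e1, h]
  simp only [mul_sub, sub_mul, mul_smul_comm, smul_mul_assoc, mul_one]
  rw [mul_assoc _ (rot X (θ + φ)), rot_mul_rotDen hX, rotDen_mul_rot hX]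

lemma continuous_rot [CompleteSpace A] {X : A} (hX : IsRotatable X) : Continuous (rot X) := by
  refine (continuous_rotNum X).mul (continuous_iff_continuousAt.2 fun θ => ?_)
  obtain ⟨u, hu⟩ := hX θ
  have := NormedRing.inverse_continuousAt u
  rw [hu] at this
  exact ContinuousAt.comp (f := rotDen X) this (continuous_rotDen X).continuousAt

lemma integral_rot_add {X : A} (hX : IsRotatable X) (φ : ℝ) :
    ∫ θ in (0 : ℝ)..Real.pi, rot X (θ + φ) = ∫ θ in (0 : ℝ)..Real.pi, rot X θ := by
  have hp : Function.Periodic (rot X) Real.pi := rot_add_pi hX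
  rw [intervalIntegral.integral_comp_add_right, zero_add, add_comm]
  simpa using hp.intervalIntegral_add_eq φ 0

/-- In `rot_mul_rot` the difference `rot X (θ + φ) - rot X θ` integrates to zero over a period, and
only the constant term survives. -/
lemma integral_rot_mul_rot_add [CompleteSpace A] {X : A} (hX : IsRotatable X) {φ : ℝ}
    (hφ : Real.sin φ ≠ 0) :
    ∫ θ in (0 : ℝ)..Real.pi, rot X θ * rot X (θ + φ) = -(Real.pi • (1 : A)) := by
  have hc := continuous_rot hX
  have hc' : Continuous fun θ => rot X (θ + φ) := hc.comp (by fun_prop)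
  have h : Real.sin φ • ∫ θ in (0 : ℝ)..Real.pi, rot X θ * rot X (θ + φ) =
      -(Real.sin φ • (Real.pi • (1 : A))) := by
    rw [← intervalIntegral.integral_smul]
    simp_rw [rot_mul_rot hX]
    rw [intervalIntegral.integral_sub, intervalIntegral.integral_smul,
      intervalIntegral.integral_sub, integral_rot_add hX, sub_self, smul_zero, zero_sub,
      intervalIntegral.integral_const, sub_zero, smul_comm]
    · exact hc'.intervalIntegrable _ _
    · exact hc.intervalIntegrable _ _
    · exact ((hc'.sub hc).const_smul _).intervalIntegrable _ _
    · exact continuous_const.intervalIntegrable _ _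
  rw [← smul_neg] at h
  exact smul_right_injective A hφ h

/-- By periodicity the square is a double integral of `rot X θ * rot X (θ + φ)`. Integrating over
`θ` first gives `-π` for every `φ` in the open interval `(0, π)`. -/
lemma rotAvg_mul_self [CompleteSpace A] {X : A} (hX : IsRotatable X) :
    rotAvg X * rotAvg X = -1 := by
  have hc := continuous_rot hX
  have hpi := Real.pi_pos
  have key : (∫ θ in (0 : ℝ)..Real.pi, rot X θ) * (∫ θ in (0 : ℝ)..Real.pi, rot X θ) =
      -((Real.pi * Real.pi) • (1 : A)) := by
    have hcc : Continuous (Function.uncurry fun θ φ => rot X θ * rot X (θ + φ)) :=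
      (hc.comp continuous_fst).mul (hc.comp (continuous_fst.add continuous_snd))
    calc (∫ θ in (0 : ℝ)..Real.pi, rot X θ) * (∫ θ in (0 : ℝ)..Real.pi, rot X θ)
        = ∫ θ in (0 : ℝ)..Real.pi, rot X θ * ∫ φ in (0 : ℝ)..Real.pi, rot X φ := by
          exact ((ContinuousLinearMap.mul ℝ A).flip _).intervalIntegral_comp_comm
            (hc.intervalIntegrable _ _) |>.symm
      _ = ∫ θ in (0 : ℝ)..Real.pi, ∫ φ in (0 : ℝ)..Real.pi, rot X θ * rot X (θ + φ) := by
          congr 1; ext θ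
          have : ∫ φ in (0 : ℝ)..Real.pi, rot X φ = ∫ φ in (0 : ℝ)..Real.pi, rot X (θ + φ) := by
            rw [← integral_rot_add hX θ]; simp_rw [add_comm]
          rw [this]
          exact ((ContinuousLinearMap.mul ℝ A) (rot X θ)).intervalIntegral_comp_comm
            ((hc.comp (by fun_prop)).intervalIntegrable _ _) |>.symm
      _ = ∫ φ in (0 : ℝ)..Real.pi, ∫ θ in (0 : ℝ)..Real.pi, rot X θ * rot X (θ + φ) :=
          MeasureTheory.intervalIntegral_intervalIntegral_swap <|
            (hcc.continuousOn.integrableOn_compact (isCompact_uIcc.prod isCompact_uIcc)).mono_set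
              (prod_mono uIoc_subset_uIcc uIoc_subset_uIcc)
      _ = ∫ φ in (0 : ℝ)..Real.pi, -(Real.pi • (1 : A)) := by
          -- The endpoints have to be discarded, since `sin φ` vanishes there.
          simp only [intervalIntegral.integral_of_le hpi.le,
            MeasureTheory.integral_Ioc_eq_integral_Ioo]
          refine MeasureTheory.setIntegral_congr_fun measurableSet_Ioo fun φ hφ => ?_
          have := integral_rot_mul_rot_add hX (φ := φ) (Real.sin_pos_of_mem_Ioo hφ).ne'
          rwa [intervalIntegral.integral_of_le hpi.le,
            MeasureTheory.integral_Ioc_eq_integral_Ioo] at this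
      _ = _ := by
          rw [intervalIntegral.integral_const, sub_zero, smul_neg, smul_smul]
  rw [rotAvg, smul_mul_smul_comm, key, smul_neg, smul_smul]
  rw [show 1 / Real.pi * (1 / Real.pi) * (Real.pi * Real.pi) = 1 by field_simp, one_smul]

lemma apply_rotAvg [CompleteSpace A] {F : Type*} [NormedAddCommGroup F] [NormedSpace ℝ F]
    [CompleteSpace F]
    {X : A} (hX : IsRotatable X) (f : A →L[ℝ] F) :
    f (rotAvg X) = (1 / Real.pi) • ∫ θ in (0 : ℝ)..Real.pi, f (rot X θ) := by
  rw [rotAvg, map_smul, f.intervalIntegral_comp_comm ((continuous_rot hX).intervalIntegrable _ _)]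

section Naturality

variable {B : Type*} [NormedRing B] [NormedAlgebra ℝ B]

lemma map_rotDen (f : A →ₐ[ℝ] B) (X : A) (θ : ℝ) : f (rotDen X θ) = rotDen (f X) θ := by
  simp [rotDen]

lemma IsRotatable.map {X : A} (hX : IsRotatable X) (f : A →ₐ[ℝ] B) : IsRotatable (f X) :=
  fun θ => map_rotDen f X θ ▸ (hX θ).map f

lemma map_rot {X : A} (hX : IsRotatable X) (f : A →ₐ[ℝ] B) (θ : ℝ) :
    f (rot X θ) = rot (f X) θ := by
  have h1 : f (rot X θ) * rotDen (f X) θ = rotNum (f X) θ := by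
    rw [← map_rotDen, ← map_mul, rot_mul_rotDen hX, rotNum, rotNum]
    simp only [map_add, map_smul, map_one]
  rw [← rot_mul_rotDen (hX.map f)] at h1
  exact (hX.map f θ).mul_left_injective h1

/-- Applied to conjugations, this makes the average independent of the frame in which an
endomorphism is written. -/
lemma map_rotAvg [CompleteSpace A] [CompleteSpace B] {X : A} (hX : IsRotatable X)
    (f : A →ₐ[ℝ] B) (hf : Continuous f) :
    f (rotAvg X) = rotAvg (f X) := by
  have h : f (rotAvg X) = (1 / Real.pi) • ∫ θ in (0 : ℝ)..Real.pi, f (rot X θ) :=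
    apply_rotAvg hX ⟨f.toLinearMap, hf⟩
  simp_rw [map_rot hX f] at h
  exact h

end Naturality

section Smoothness

lemma ring_inverse_apply {R : Type*} [NormedRing R] {K : Type*} [TopologicalSpace K] {f : C(K, R)}
    (hf : IsUnit f) (x : K) : (Ring.inverse f) x = Ring.inverse (f x) := by
  obtain ⟨u, rfl⟩ := hf
  have h : (u : C(K, R)) x =
      (Units.map ((Pi.evalMonoidHom (fun _ : K => R) x).comp ContinuousMap.coeFnMonoidHom) u : Rˣ) := rfl
  rw [h, Ring.inverse_unit, Ring.inverse_unit, ← map_inv]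
  rfl

/-- Integration over `[0, π]`. -/
def integralCLM : C(Icc (0 : ℝ) Real.pi, A) →L[ℝ] A :=
  LinearMap.mkContinuous
    { toFun := fun f => ∫ θ in (0 : ℝ)..Real.pi, Set.IccExtend Real.pi_pos.le f θ
      map_add' := fun f g => by
        rw [← intervalIntegral.integral_add]
        · rfl
        · exact (f.continuous.Icc_extend').intervalIntegrable _ _
        · exact (g.continuous.Icc_extend').intervalIntegrable _ _
      map_smul' := fun c f => by
        rw [RingHom.id_apply, ← intervalIntegral.integral_smul]; rfl }
    Real.pi fun f => by
      have := intervalIntegral.norm_integral_le_of_norm_le_const (a := 0) (b := Real.pi) (C := ‖f‖)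
        (f := Set.IccExtend Real.pi_pos.le f) fun θ _ => f.norm_coe_le_norm _
      simpa [abs_of_pos Real.pi_pos, mul_comm] using this

/-- The whole orbit is one element of the Banach algebra `C([0, π], A)`. There inversion is smooth
at units, numerator and denominator are affine in `X`, and integration is continuous and linear. -/
lemma contDiffAt_rotAvg [CompleteSpace A] {X : A} (hX : IsRotatable X) :
    ContDiffAt ℝ ∞ (rotAvg : A → A) X := by
  let cst : A →L[ℝ] C(Icc (0 : ℝ) Real.pi, A) := ContinuousLinearMap.const ℝ _
  let c : C(Icc (0 : ℝ) Real.pi, A) := ⟨fun θ => Real.cos θ • (1 : A), by fun_prop⟩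
  let s : C(Icc (0 : ℝ) Real.pi, A) := ⟨fun θ => Real.sin θ • (1 : A), by fun_prop⟩
  let den : A → C(Icc (0 : ℝ) Real.pi, A) := fun Y => c - s * cst Y
  let num : A → C(Icc (0 : ℝ) Real.pi, A) := fun Y => c * cst Y + s
  have hden : ∀ Y θ, den Y θ = rotDen Y θ := fun Y θ => by
    simp [den, c, s, rotDen, cst]
  have hnum : ∀ Y θ, num Y θ = rotNum Y θ := fun Y θ => by
    simp [num, c, s, rotNum, cst]
  have hu : ∀ Y, IsUnit (den Y) →
      (1 / Real.pi) • integralCLM (num Y * Ring.inverse (den Y)) = rotAvg Y := by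
    intro Y hY
    rw [rotAvg]
    congr 1
    change ∫ θ in (0 : ℝ)..Real.pi,
      Set.IccExtend Real.pi_pos.le (num Y * Ring.inverse (den Y)) θ = _
    refine intervalIntegral.integral_congr fun θ hθ => ?_
    rw [uIcc_of_le Real.pi_pos.le] at hθ
    simp only [IccExtend_of_mem _ _ hθ, ContinuousMap.mul_apply, ring_inverse_apply hY, hden,
      hnum, rot]
  have hXu : IsUnit (den X) := by
    rw [ContinuousMap.isUnit_iff_forall_isUnit]
    exact fun θ => hden X θ ▸ hX θ
  have hdsm : ContDiff ℝ ∞ den := contDiff_const.sub (contDiff_const.mul cst.contDiff)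
  have hnsm : ContDiff ℝ ∞ num := (contDiff_const.mul cst.contDiff).add contDiff_const
  have hev : ∀ᶠ Y in 𝓝 X, IsUnit (den Y) :=
    hdsm.continuous.continuousAt.eventually (Units.isOpen.mem_nhds hXu)
  refine ContDiffAt.congr_of_eventuallyEq ?_ (hev.mono fun Y hY => (hu Y hY).symm)
  have hinv : ContDiffAt ℝ ∞ Ring.inverse (den X) := by
    obtain ⟨u, hu⟩ := hXu
    exact hu ▸ contDiffAt_ringInverse ℝ u
  refine ContDiffAt.const_smul (1 / Real.pi) ((integralCLM (A := A)).contDiff.contDiffAt.comp X ?_)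
  exact hnsm.contDiffAt.mul (hinv.comp X hdsm.contDiffAt)

end Smoothness

end CayleyAverage

/-! ### Rotation averages of tamed endomorphisms -/

section Endomorphisms

variable {E : Type*} [NormedAddCommGroup E] [NormedSpace ℝ E] [FiniteDimensional ℝ E]

/-- A continuous bilinear form which is positive on the pairs `(v, K v)`, `v ≠ 0`, is alternating
by assumption; then the rotations of `K` are defined. -/
lemma isRotatable_of_tame {B : E →ₗ[ℝ] E →ₗ[ℝ] ℝ} (hB : B.IsAlt) {K : E →L[ℝ] E}
    (hK : ∀ v, v ≠ 0 → 0 < B v (K v)) : IsRotatable K := by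
  intro θ
  have hinj : Function.Injective (rotDen K θ : E →L[ℝ] E) := by
    rw [injective_iff_map_eq_zero]
    intro v hv
    by_contra hne
    have h0 : Real.cos θ • v = Real.sin θ • K v := by
      have : Real.cos θ • v - Real.sin θ • K v = 0 := by simpa [rotDen] using hv
      exact sub_eq_zero.1 this
    have h1 : Real.sin θ * B v (K v) = 0 := by
      have := congrArg (B v) h0
      simpa [hB.self_eq_zero v] using this.symm
    have h2 : Real.cos θ * B v (K v) = 0 := by
      have := congrArg (fun w => B w (K v)) h0
      simpa [hB.self_eq_zero (K v)] using this
    have hp := hK v hne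
    have := Real.sin_sq_add_cos_sq θ
    have hs : Real.sin θ = 0 := by simpa [hp.ne'] using h1
    have hc : Real.cos θ = 0 := by simpa [hp.ne'] using h2
    rw [hs, hc] at this
    norm_num at this
  rw [ContinuousLinearMap.isUnit_iff_bijective]
  exact ⟨hinj, ((rotDen K θ : E →L[ℝ] E) : E →ₗ[ℝ] E).injective_iff_surjective.1 hinj⟩

/-- The denominator maps `S` injectively to itself, hence onto `S` by dimension. Writing `v` as a
denominator applied to `u ∈ S` avoids inverses in the later computations. -/
lemma rot_mem {K : E →L[ℝ] E} (hK : IsRotatable K) {S : Submodule ℝ E}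
    (hS : ∀ v ∈ S, K v ∈ S) {v : E} (hv : v ∈ S) (θ : ℝ) :
    ∃ u ∈ S, v = rotDen K θ u ∧ rot K θ v = rotNum K θ u ∧ rotNum K θ u ∈ S := by
  have hd : ∀ v ∈ S, rotDen K θ v ∈ S := fun v hv => by
    simpa [rotDen] using S.sub_mem (S.smul_mem _ hv) (S.smul_mem _ (hS v hv))
  have hinj : Function.Injective (rotDen K θ : E →L[ℝ] E) :=
    ((ContinuousLinearMap.isUnit_iff_bijective).1 (hK θ)).1
  let f : S →ₗ[ℝ] S := ((rotDen K θ : E →L[ℝ] E) : E →ₗ[ℝ] E).restrict hd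
  have hf : Function.Injective f := fun x y hxy => by
    have := congrArg Subtype.val hxy
    exact Subtype.ext (hinj this)
  obtain ⟨u, hu⟩ := LinearMap.injective_iff_surjective.1 hf ⟨v, hv⟩
  have hu' : rotDen K θ u = v := congrArg Subtype.val hu
  refine ⟨u, u.2, hu'.symm, ?_, ?_⟩
  · rw [← hu', ← rot_mul_rotDen hK]; rfl
  · simpa [rotNum] using S.add_mem (S.smul_mem _ (hS u u.2)) (S.smul_mem _ u.2)

lemma rotAvg_apply_mem {K : E →L[ℝ] E} (hK : IsRotatable K) {S : Submodule ℝ E}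
    (hS : ∀ v ∈ S, K v ∈ S) {v : E} (hv : v ∈ S) : rotAvg K v ∈ S := by
  have := apply_rotAvg hK (ContinuousLinearMap.apply ℝ E v)
  simp only [ContinuousLinearMap.apply_apply] at this
  rw [this]
  refine S.smul_mem _ ?_
  -- A linear functional vanishing on `S` vanishes on the integrand, hence on the integral.
  by_contra hne
  obtain ⟨f, hf, hfS⟩ := Submodule.exists_le_ker_of_notMem hne
  refine hf ?_
  have hc : Continuous fun θ => rot K θ v :=
    (ContinuousLinearMap.apply ℝ E v).continuous.comp (continuous_rot hK)
  have := (LinearMap.toContinuousLinearMap f).intervalIntegral_comp_comm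
    (hc.intervalIntegrable (μ := MeasureTheory.volume) 0 Real.pi)
  simp only [LinearMap.coe_toContinuousLinearMap'] at this
  rw [← this]
  have h0 : ∀ θ, f (rot K θ v) = 0 := fun θ => by
    obtain ⟨u, -, -, h, h'⟩ := rot_mem hK hS hv θ
    exact hfS (h ▸ h')
  simp [h0]

/-- With `v = cos θ u - sin θ K u`, the value of `B` on `v` and its rotated image is `(cos² θ + sin²
θ) B(u, K u)`, because `B` is alternating. So each rotation is tamed on `S`, and the average is an
integral of positive functions. -/
lemma rotAvg_tame {K : E →L[ℝ] E} (hK : IsRotatable K) {S : Submodule ℝ E}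
    (hS : ∀ v ∈ S, K v ∈ S) {B : E →ₗ[ℝ] E →ₗ[ℝ] ℝ} (hB : B.IsAlt)
    (hBK : ∀ v ∈ S, v ≠ 0 → 0 < B v (K v)) {v : E} (hv : v ∈ S) (hv0 : v ≠ 0) :
    0 < B v (rotAvg K v) := by
  have hc : Continuous fun θ => rot K θ v :=
    (ContinuousLinearMap.apply ℝ E v).continuous.comp (continuous_rot hK)
  have h := apply_rotAvg hK ((LinearMap.toContinuousLinearMap (B v)).comp
    (ContinuousLinearMap.apply ℝ E v))
  simp only [ContinuousLinearMap.comp_apply, ContinuousLinearMap.apply_apply,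
    LinearMap.coe_toContinuousLinearMap'] at h
  rw [h, smul_eq_mul]
  refine mul_pos (by positivity) (intervalIntegral.intervalIntegral_pos_of_pos
    (((LinearMap.toContinuousLinearMap (B v)).continuous.comp hc).intervalIntegrable _ _)
    (fun θ => ?_) Real.pi_pos)
  obtain ⟨u, hu, hvu, hr, -⟩ := rot_mem hK hS hv θ
  have hu0 : u ≠ 0 := by rintro rfl; exact hv0 (by simp [hvu])
  change 0 < B v (rot K θ v)
  rw [hr, hvu]
  have e : B (rotDen K θ u) (rotNum K θ u) = B u (K u) := by
    have hs := hB.neg (K u) u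
    have := Real.sin_sq_add_cos_sq θ
    simp only [rotDen, rotNum, _root_.sub_apply, _root_.add_apply,
      _root_.smul_apply, one_apply_eq_self, map_sub, map_add, map_smul,
      LinearMap.sub_apply, LinearMap.smul_apply, hB.self_eq_zero, smul_eq_mul]
    rw [← hs]
    linear_combination (-(B (K u) u)) * this
  rw [e]
  exact hBK u hu hu0

end Endomorphisms


/-! ### Linear algebra: endomorphisms tamed by two forms -/

section TamePairs

/-- In finite dimension, the convex hull of a compact set is compact. -/
lemma isCompact_convexHull {F : Type*} [NormedAddCommGroup F] [NormedSpace ℝ F]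
    [FiniteDimensional ℝ F] {s : Set F} (hs : IsCompact s) : IsCompact (convexHull ℝ s) := by
  obtain rfl | ⟨s₀, hs₀⟩ := s.eq_empty_or_nonempty
  · simp
  -- Carathéodory: `dim F + 1` points suffice, so the hull is a continuous image of a simplex times
  -- a power of `s`.
  let n := finrank ℝ F + 1
  let Φ : (Fin n → ℝ) × (Fin n → F) → F := fun p => ∑ i, p.1 i • p.2 i
  have hΦ : Continuous Φ := by fun_prop
  have hc : IsCompact (stdSimplex ℝ (Fin n) ×ˢ univ.pi fun _ : Fin n => s) :=
    (isCompact_stdSimplex ℝ (Fin n)).prod (isCompact_univ_pi fun _ => hs)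
  convert hc.image hΦ
  refine Subset.antisymm (fun x hx => ?_) ?_
  · obtain ⟨ι, _, z, w, hz, hai, hw, hw1, rfl⟩ := eq_pos_convex_span_of_mem_convexHull hx
    have hcard : Fintype.card ι ≤ Fintype.card (Fin n) := by
      simpa [n] using hai.card_le_finrank_succ.trans
        (Nat.succ_le_succ (Submodule.finrank_le _))
    obtain ⟨e⟩ := Function.Embedding.nonempty_of_card_le hcard
    have h0 : ∀ j, j ∉ range e → Function.extend e w 0 j = 0 := fun j hj =>
      Function.extend_apply' _ _ _ hj
    -- Unused indices get weight `0` and the arbitrary point `s₀` of `s`.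
    refine ⟨(Function.extend e w 0, Function.extend e z fun _ => s₀), ⟨⟨fun j => ?_, ?_⟩, ?_⟩, ?_⟩
    · by_cases hj : ∃ i, e i = j
      · obtain ⟨i, rfl⟩ := hj
        simpa [e.injective.extend_apply] using (hw i).le
      · exact (h0 j hj).ge
    · rw [← hw1]
      exact (Fintype.sum_of_injective e e.injective _ _ h0
        fun i => (e.injective.extend_apply _ _ i).symm).symm
    · rintro j -
      by_cases hj : ∃ i, e i = j
      · obtain ⟨i, rfl⟩ := hj
        simpa [e.injective.extend_apply] using hz ⟨i, rfl⟩
      · simpa [Function.extend_apply' _ _ _ hj] using hs₀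
    · refine (Fintype.sum_of_injective e e.injective _ _ (fun j hj => ?_) fun i => ?_).symm
      · simp [h0 j hj]
      · simp [e.injective.extend_apply]
  · rintro _ ⟨⟨w, z⟩, ⟨⟨hw0, hw1⟩, hz⟩, rfl⟩
    exact (convex_convexHull ℝ s).sum_mem (fun i _ => hw0 i) hw1
      fun i _ => subset_convexHull ℝ s (hz i (mem_univ i))

variable {T : Type*} [NormedAddCommGroup T] [InnerProductSpace ℝ T]

open scoped RealInnerProductSpace

/-- Gordan's alternative for a compact set of linear functionals. -/
lemma exists_forall_pos_of_isCompact {X : Type*} [NormedAddCommGroup X] [NormedSpace ℝ X]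
    [FiniteDimensional ℝ X] {D : Set (X →L[ℝ] ℝ)} (hD : IsCompact D) (h0 : 0 ∉ convexHull ℝ D) :
    ∃ x : X, ∀ ψ ∈ D, 0 < ψ x := by
  obtain ⟨f, u, hu, hf⟩ := geometric_hahn_banach_point_closed (convex_convexHull ℝ D)
    (isCompact_convexHull hD).isClosed h0
  rw [map_zero] at hu
  -- The separating functional lies in the bidual of `X`; by finite dimension it is evaluation at a
  -- vector.
  refine ⟨(Module.evalEquiv ℝ X).symm (f.toLinearMap ∘ₗ
    (LinearMap.toContinuousLinearMap : (X →ₗ[ℝ] ℝ) ≃ₗ[ℝ] (X →L[ℝ] ℝ)).toLinearMap),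
    fun ψ hψ => ?_⟩
  have := Module.apply_evalEquiv_symm_apply (R := ℝ) (M := X) ψ.toLinearMap (f.toLinearMap ∘ₗ
    (LinearMap.toContinuousLinearMap : (X →ₗ[ℝ] ℝ) ≃ₗ[ℝ] (X →L[ℝ] ℝ)).toLinearMap)
  refine lt_of_lt_of_eq (hu.trans (hf ψ (subset_convexHull ℝ D hψ))) this.symm

/-- Positive semidefinite symmetric operators. -/
structure IsSymmPSD (P : T →ₗ[ℝ] T) : Prop where
  symm : ∀ x y, ⟪P x, y⟫ = ⟪x, P y⟫
  nonneg : ∀ x, 0 ≤ ⟪P x, x⟫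

/-- Otherwise the quadratic form at `x + t P x` has linear term `2t‖P x‖²` and no constant term, so
it is negative for small `t < 0`. -/
lemma IsSymmPSD.apply_eq_zero {P : T →ₗ[ℝ] T} (hP : IsSymmPSD P) {x : T} (hx : ⟪P x, x⟫ = 0) :
    P x = 0 := by
  by_contra hne
  have hn : 0 < ⟪P x, P x⟫ := real_inner_self_pos.2 hne
  have h : ∀ t : ℝ, 0 ≤ 2 * t * ⟪P x, P x⟫ + t * t * ⟪P (P x), P x⟫ := fun t => by
    have := hP.nonneg (x + t • P x)
    have hs := hP.symm (P x) x
    simp only [map_add, map_smul, inner_add_left, inner_add_right, inner_smul_left,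
      inner_smul_right, hx, conj_trivial, hs] at this
    linarith
  set a := ⟪P x, P x⟫
  set b := ⟪P (P x), P x⟫
  have hb : 0 ≤ b := hP.nonneg _
  -- The minimum is at `-a / b`; `b + 1` avoids dividing by zero and still gives a negative value.
  have := h (-(a / (b + 1)))
  have hb1 : 0 < b + 1 := by linarith
  have e : 2 * -(a / (b + 1)) * a + -(a / (b + 1)) * -(a / (b + 1)) * b =
      -(a ^ 2 * (b + 2)) / (b + 1) ^ 2 := by field_simp; ring
  rw [e] at this
  have : -(a ^ 2 * (b + 2)) / (b + 1) ^ 2 < 0 := by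
    apply div_neg_of_neg_of_pos
    · have : 0 < a ^ 2 * (b + 2) := by positivity
      linarith
    · positivity
  linarith

lemma IsSymmPSD.add {P Q : T →ₗ[ℝ] T} (hP : IsSymmPSD P) (hQ : IsSymmPSD Q) :
    IsSymmPSD (P + Q) where
  symm x y := by simp [inner_add_left, inner_add_right, hP.symm, hQ.symm]
  nonneg x := by
    simpa [inner_add_left] using add_nonneg (hP.nonneg x) (hQ.nonneg x)

lemma IsSymmPSD.smul {P : T →ₗ[ℝ] T} (hP : IsSymmPSD P) {c : ℝ} (hc : 0 ≤ c) :
    IsSymmPSD (c • P) where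
  symm x y := by simp [inner_smul_left, inner_smul_right, hP.symm]
  nonneg x := by
    simpa [inner_smul_left] using mul_nonneg hc (hP.nonneg x)

/-- The rank one operator `z ↦ ⟪v, z⟫ v`. -/
def rankOneSelf (v : T) : T →ₗ[ℝ] T := (InnerProductSpace.rankOne ℝ v v : T →L[ℝ] T)

lemma rankOneSelf_apply (v z : T) : rankOneSelf v z = ⟪v, z⟫ • v := by
  simp [rankOneSelf]

lemma isSymmPSD_rankOneSelf (v : T) : IsSymmPSD (rankOneSelf v) where
  symm x y := by
    simp only [rankOneSelf_apply, inner_smul_left, inner_smul_right, conj_trivial,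
      real_inner_comm x v]
    ring
  nonneg x := by
    simp only [rankOneSelf_apply, inner_smul_left, conj_trivial]
    exact mul_self_nonneg _

lemma isSymmPSD_zero : IsSymmPSD (0 : T →ₗ[ℝ] T) := ⟨by simp, by simp⟩

variable [FiniteDimensional ℝ T]

/-- Of two positive semidefinite operators, not both zero, one is at some point a nonnegative
multiple of the other, in a nontrivial way. -/
lemma exists_apply_eq_smul_apply {P Q : T →ₗ[ℝ] T} (hP : IsSymmPSD P) (hQ : IsSymmPSD Q)
    (hPQ : P ≠ 0 ∨ Q ≠ 0) :
    (∃ m, P m = 0 ∧ Q m ≠ 0) ∨ ∃ m, ∃ c : ℝ, 0 ≤ c ∧ P m ≠ 0 ∧ Q m = c • P m := by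
  by_cases hk : ∃ m, P m = 0 ∧ Q m ≠ 0
  · exact Or.inl hk
  right
  push Not at hk
  -- From here on `ker P ≤ ker Q`, so both operators live on the orthogonal complement of `ker P`,
  -- where `P` is positive definite.
  have hP0 : P ≠ 0 := by
    rintro rfl
    exact hPQ.elim (fun h => h rfl) fun h => h (LinearMap.ext fun m => hk m rfl)
  let K : Submodule ℝ T := P.ker
  have hpos : ∀ m ∈ Kᗮ, m ≠ 0 → 0 < ⟪P m, m⟫ := fun m hm hm0 => by
    refine lt_of_le_of_ne (hP.nonneg m) fun h => hm0 ?_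
    have h1 : m ∈ K := hP.apply_eq_zero h.symm
    exact inner_self_eq_zero.1 (hm m h1)
  have hcP : Continuous fun m => ⟪P m, m⟫ := P.continuous_of_finiteDimensional.inner continuous_id
  have hcQ : Continuous fun m => ⟪Q m, m⟫ := Q.continuous_of_finiteDimensional.inner continuous_id
  let s : Set T := Metric.sphere 0 1 ∩ Kᗮ
  have hs : IsCompact s := (isCompact_sphere 0 1).inter_right Kᗮ.closed_of_finiteDimensional
  have hs0 : ∀ m ∈ s, m ≠ 0 := by
    rintro m ⟨hm, -⟩ rfl
    simp at hm
  have hne : s.Nonempty := by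
    obtain ⟨m, hm⟩ : ∃ m, P m ≠ 0 := by
      by_contra h
      push Not at h
      exact hP0 (LinearMap.ext h)
    have hd : K ≠ ⊤ := fun h => hm (by
      have : m ∈ K := h ▸ Submodule.mem_top
      exact this)
    have hKo : Kᗮ ≠ ⊥ := fun h => hd (Submodule.orthogonal_eq_bot_iff.1 h)
    obtain ⟨n, hn, hn0⟩ := Submodule.exists_mem_ne_zero_of_ne_bot hKo
    exact ⟨(‖n‖)⁻¹ • n, by simp [norm_smul, hn0], Kᗮ.smul_mem _ hn⟩
  obtain ⟨m, hm, hmax⟩ := hs.exists_isMaxOn hne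
    (f := fun m => ⟪Q m, m⟫ / ⟪P m, m⟫)
    (hcQ.continuousOn.div hcP.continuousOn fun m hm => (hpos m hm.2 (hs0 m hm)).ne')
  have hm1 := hpos m hm.2 (hs0 m hm)
  set c := ⟪Q m, m⟫ / ⟪P m, m⟫ with hc
  have hc0 : 0 ≤ c := div_nonneg (hQ.nonneg m) hm1.le
  have hle : ∀ n ∈ Kᗮ, ⟪Q n, n⟫ ≤ c * ⟪P n, n⟫ := fun n hn => by
    by_cases hn0 : n = 0
    · simp [hn0]
    have h1 : (‖n‖)⁻¹ • n ∈ s := ⟨by simp [norm_smul, hn0], Kᗮ.smul_mem _ hn⟩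
    have h2 := hmax h1
    simp only [mem_ofPred_eq, map_smul, inner_smul_left, inner_smul_right, conj_trivial] at h2
    have hnn : ‖n‖⁻¹ ≠ 0 := inv_ne_zero (norm_ne_zero_iff.2 hn0)
    rw [mul_div_mul_left _ _ hnn, mul_div_mul_left _ _ hnn, div_le_iff₀ (hpos n hn hn0)] at h2
    exact h2
  have hR : IsSymmPSD (c • P - Q) := by
    refine ⟨fun x y => ?_, fun x => ?_⟩
    · simp [inner_sub_left, inner_sub_right, inner_smul_left, inner_smul_right, hP.symm, hQ.symm]
    · obtain ⟨y, hy, z, hz, rfl⟩ := K.exists_add_mem_mem_orthogonal x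
      have hPy : P y = 0 := hy
      have hQy : Q y = 0 := hk y hy
      have h1 : ⟪P z, y⟫ = 0 := by rw [hP.symm, hPy, inner_zero_right]
      have h2 : ⟪Q z, y⟫ = 0 := by rw [hQ.symm, hQy, inner_zero_right]
      have := hle z hz
      have e : (c • P - Q) (y + z) = c • P z - Q z := by simp [hPy, hQy]
      rw [e]
      simp only [inner_sub_left, inner_add_right, inner_smul_left, conj_trivial, h1, h2]
      linarith
  refine ⟨m, c, hc0, fun h => ?_, ?_⟩
  · rw [h, inner_zero_left] at hm1
    exact lt_irrefl _ hm1
  · have h0 : ⟪(c • P - Q) m, m⟫ = 0 := by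
      simp only [LinearMap.sub_apply, LinearMap.smul_apply, inner_sub_left, inner_smul_left,
        conj_trivial, hc]
      field_simp
      ring
    have := hR.apply_eq_zero h0
    rw [LinearMap.sub_apply, LinearMap.smul_apply, sub_eq_zero] at this
    exact this.symm

/-- The functional `K ↦ B (v, K v)` on endomorphisms. -/
def tameFunctional (B : T →ₗ[ℝ] T →ₗ[ℝ] ℝ) (v : T) : (T →L[ℝ] T) →L[ℝ] ℝ :=
  (LinearMap.toContinuousLinearMap (B v)).comp (ContinuousLinearMap.apply ℝ T v)

lemma tameFunctional_apply (B : T →ₗ[ℝ] T →ₗ[ℝ] ℝ) (v : T) (K : T →L[ℝ] T) :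
    tameFunctional B v K = B v (K v) := rfl

lemma continuous_tameFunctional (B : T →ₗ[ℝ] T →ₗ[ℝ] ℝ) : Continuous (tameFunctional B) := by
  have h1 : Continuous fun v => LinearMap.toContinuousLinearMap (B v) :=
    ((LinearMap.toContinuousLinearMap : (T →ₗ[ℝ] ℝ) ≃ₗ[ℝ] (T →L[ℝ] ℝ)).toLinearMap ∘ₗ
      B).continuous_of_finiteDimensional
  exact h1.clm_comp (ContinuousLinearMap.apply ℝ T).continuous

/-- If the nonnegative combinations of two bilinear forms are nondegenerate, then there is an
endomorphism which is tamed by both. -/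
theorem exists_tame_pair (B₀ B₁ : T →ₗ[ℝ] T →ₗ[ℝ] ℝ)
    (h : ∀ t : ℝ, 0 ≤ t → ∀ v, (∀ w, B₀ v w + t * B₁ v w = 0) → v = 0)
    (h₁ : ∀ v, (∀ w, B₁ v w = 0) → v = 0) :
    ∃ K : T →L[ℝ] T, ∀ v, v ≠ 0 → 0 < B₀ v (K v) ∧ 0 < B₁ v (K v) := by
  let b := stdOrthonormalBasis ℝ T
  let tr : (T →ₗ[ℝ] T) → ℝ := fun P => ∑ i, ⟪P (b i), b i⟫
  have htr : ∀ (c d : ℝ) P Q, tr (c • P + d • Q) = c * tr P + d * tr Q := fun c d P Q => by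
    simp only [tr, LinearMap.add_apply, LinearMap.smul_apply, inner_add_left, inner_smul_left,
      conj_trivial, Finset.sum_add_distrib, Finset.mul_sum]
  have htr1 : ∀ v : T, ‖v‖ = 1 → tr (rankOneSelf v) = 1 := fun v hv => by
    have := b.sum_sq_norm_inner_right v
    rw [hv] at this
    simp only [tr, rankOneSelf_apply, inner_smul_left, conj_trivial]
    simp only [Real.norm_eq_abs, sq_abs] at this
    rw [one_pow] at this
    rw [← this]
    refine Finset.sum_congr rfl fun i _ => ?_
    rw [real_inner_comm v, sq]
  have htr0 : tr 0 = 0 := by simp [tr]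
  -- A convex set containing all `K ↦ Bᵢ(v, K v)` with `‖v‖ = 1`, for which `P` or `Q` is the rank
  -- one operator of `v`. The trace normalization keeps `P` and `Q` from both being zero.
  let S : Set ((T →L[ℝ] T) →L[ℝ] ℝ) := {ψ | ∃ P Q : T →ₗ[ℝ] T, IsSymmPSD P ∧ IsSymmPSD Q ∧
    tr P + tr Q = 1 ∧ ∀ m x : T, ψ (InnerProductSpace.rankOne ℝ x m) = B₀ (P m) x + B₁ (Q m) x}
  have hS : Convex ℝ S := by
    rintro ψ ⟨P, Q, hP, hQ, hPQ, hψ⟩ ψ' ⟨P', Q', hP', hQ', hPQ', hψ'⟩ c d hc hd hcd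
    refine ⟨c • P + d • P', c • Q + d • Q', (hP.smul hc).add (hP'.smul hd),
      (hQ.smul hc).add (hQ'.smul hd), ?_, fun m x => ?_⟩
    · rw [htr, htr]
      linear_combination c * hPQ + d * hPQ' + hcd
    · simp only [_root_.add_apply, _root_.smul_apply, hψ, hψ', LinearMap.add_apply,
        LinearMap.smul_apply, map_add, map_smul, smul_eq_mul]
      ring
  let D : Set ((T →L[ℝ] T) →L[ℝ] ℝ) :=
    tameFunctional B₀ '' Metric.sphere 0 1 ∪ tameFunctional B₁ '' Metric.sphere 0 1
  have hrk : ∀ (B : T →ₗ[ℝ] T →ₗ[ℝ] ℝ) (v m x : T),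
      tameFunctional B v (InnerProductSpace.rankOne ℝ x m) = B (rankOneSelf v m) x := by
    intro B v m x
    simp [tameFunctional_apply, rankOneSelf_apply, real_inner_comm m v]
  have hDS : D ⊆ S := by
    rintro ψ (⟨v, hv, rfl⟩ | ⟨v, hv, rfl⟩)
    · exact ⟨rankOneSelf v, 0, isSymmPSD_rankOneSelf v, isSymmPSD_zero,
        by rw [htr1 v (by simpa using hv), htr0, add_zero], fun m x => by simp [hrk]⟩
    · exact ⟨0, rankOneSelf v, isSymmPSD_zero, isSymmPSD_rankOneSelf v,
        by rw [htr1 v (by simpa using hv), htr0, zero_add], fun m x => by simp [hrk]⟩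
  have h0S : (0 : (T →L[ℝ] T) →L[ℝ] ℝ) ∉ S := by
    rintro ⟨P, Q, hP, hQ, hPQ, h0⟩
    have hne : P ≠ 0 ∨ Q ≠ 0 := by
      by_contra hcon
      push Not at hcon
      rw [hcon.1, hcon.2, htr0] at hPQ
      norm_num at hPQ
    -- Here `B₀(P m, ·) + B₁(Q m, ·) = 0`: either `Q m` is in the kernel of `B₁`, or `P m` is in the
    -- kernel of `B₀ + c B₁`.
    obtain ⟨m, hm, hm'⟩ | ⟨m, c, hc, hm, hm'⟩ := exists_apply_eq_smul_apply hP hQ hne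
    · refine hm' (h₁ _ fun w => ?_)
      have := h0 m w
      simpa [hm] using this.symm
    · refine hm (h c hc _ fun w => ?_)
      have := h0 m w
      simpa [hm'] using this.symm
  have hDc : IsCompact D :=
    ((isCompact_sphere 0 1).image (continuous_tameFunctional B₀)).union
      ((isCompact_sphere 0 1).image (continuous_tameFunctional B₁))
  obtain ⟨K, hDpos⟩ := exists_forall_pos_of_isCompact hDc fun h => h0S (convexHull_min hDS hS h)
  have hpos : ∀ B : T →ₗ[ℝ] T →ₗ[ℝ] ℝ, tameFunctional B '' Metric.sphere 0 1 ⊆ D →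
      ∀ v, v ≠ 0 → 0 < B v (K v) := fun B hB v hv => by
    have := hDpos _ (hB ⟨(‖v‖)⁻¹ • v, by simp [norm_smul, hv], rfl⟩)
    rw [tameFunctional_apply] at this
    simp only [map_smul, LinearMap.smul_apply, smul_eq_mul] at this
    have hn : 0 < ‖v‖⁻¹ := inv_pos.2 (norm_pos_iff.2 hv)
    exact pos_of_mul_pos_right (pos_of_mul_pos_right this hn.le) hn.le
  exact ⟨K, fun v hv => ⟨hpos B₀ subset_union_left v hv, hpos B₁ subset_union_right v hv⟩⟩

/-- An endomorphism tamed by an alternating form, which preserves a subspace on which it is also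
tamed by a second form. -/
theorem exists_tame_preserving {B : T →ₗ[ℝ] T →ₗ[ℝ] ℝ} (hB : B.IsAlt) (B₁ : T →ₗ[ℝ] T →ₗ[ℝ] ℝ)
    (S : Submodule ℝ T) (hnd : ∀ v, (∀ w, B v w = 0) → v = 0)
    (h : ∀ t : ℝ, 0 ≤ t → ∀ v ∈ S, (∀ w ∈ S, B v w + t * B₁ v w = 0) → v = 0)
    (h₁ : ∀ v ∈ S, (∀ w ∈ S, B₁ v w = 0) → v = 0) :
    ∃ K : T →L[ℝ] T, (∀ v, v ≠ 0 → 0 < B v (K v)) ∧ (∀ v ∈ S, K v ∈ S) ∧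
      ∀ v ∈ S, v ≠ 0 → 0 < B₁ v (K v) := by
  -- The case `t = 0` makes `B` nondegenerate on `S`, so `T` splits `B`-orthogonally. The
  -- endomorphism is a block sum, tamed by `B` and `B₁` on `S` and by `B` on `S'`.
  let S' : Submodule ℝ T := LinearMap.BilinForm.orthogonal B S
  have hS' : ∀ v ∈ S', ∀ w ∈ S, B w v = 0 := fun v hv w hw => hv w hw
  have hS'' : ∀ v ∈ S', ∀ w ∈ S, B v w = 0 := fun v hv w hw => by
    rw [← hB.neg, hS' v hv w hw, neg_zero]
  have hres : (LinearMap.BilinForm.restrict B S).Nondegenerate := by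
    have hl : ∀ v : S, (∀ w : S, B v w = 0) → v = 0 := fun v hv =>
      Subtype.ext (h 0 le_rfl v v.2 fun w hw => by simpa using hv ⟨w, hw⟩)
    refine ⟨hl, fun v hv => hl v fun w => ?_⟩
    rw [← hB.neg]
    exact neg_eq_zero.2 (hv w)
  have hc : IsCompl S S' :=
    LinearMap.BilinForm.isCompl_orthogonal_of_restrict_nondegenerate hB.isRefl hres
  obtain ⟨K₁, hK₁⟩ := exists_tame_pair (T := S) (B.domRestrict₁₂ S S) (B₁.domRestrict₁₂ S S)
    (fun t ht v hv => Subtype.ext (h t ht v v.2 fun w hw => hv ⟨w, hw⟩))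
    (fun v hv => Subtype.ext (h₁ v v.2 fun w hw => hv ⟨w, hw⟩))
  have hnd' : ∀ v : S', (∀ w : S', B v w = 0) → v = 0 := fun v hv => by
    refine Subtype.ext (hnd v fun w => ?_)
    obtain ⟨y, z, hy, hz, rfl⟩ := Submodule.codisjoint_iff_exists_add_eq.1 hc.codisjoint w
    rw [map_add, hS'' v v.2 y hy, hv ⟨z, hz⟩, add_zero]
  -- With both forms equal to `B`, the combinations are the nonzero multiples `(1 + t) B`.
  obtain ⟨K₂, hK₂⟩ := exists_tame_pair (T := S') (B.domRestrict₁₂ S' S') (B.domRestrict₁₂ S' S')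
    (fun t ht v hv => hnd' v fun w => by
      have : B v w + t * B v w = 0 := hv w
      have h2 : (1 + t) * B v w = 0 := by linarith
      exact (mul_eq_zero.1 h2).resolve_left (by positivity)) hnd'
  let p : T →ₗ[ℝ] S := S.projectionOnto S' hc
  let p' : T →ₗ[ℝ] S' := S'.projectionOnto S hc.symm
  let K : T →ₗ[ℝ] T := S.subtype ∘ₗ K₁.toLinearMap ∘ₗ p + S'.subtype ∘ₗ K₂.toLinearMap ∘ₗ p'
  have hK : ∀ (y : S) (z : S'), K (y + z) = K₁ y + K₂ z := fun y z => by
    simp [K, p, p']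
  refine ⟨LinearMap.toContinuousLinearMap K, fun v hv => ?_, fun v hv => ?_, fun v hv hv0 => ?_⟩
  · obtain ⟨y, z, hy, hz, rfl⟩ := Submodule.codisjoint_iff_exists_add_eq.1 hc.codisjoint v
    have e : B (y + z) (K (y + z)) = B y (K₁ ⟨y, hy⟩) + B z (K₂ ⟨z, hz⟩) := by
      rw [show K (y + z) = _ from hK ⟨y, hy⟩ ⟨z, hz⟩]
      simp only [map_add, LinearMap.add_apply, hS' _ (K₂ ⟨z, hz⟩).2 y hy,
        hS'' z hz _ (K₁ ⟨y, hy⟩).2]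
      ring
    rw [LinearMap.coe_toContinuousLinearMap', e]
    have n1 : 0 ≤ B y (K₁ ⟨y, hy⟩) := by
      by_cases hy0 : y = 0
      · simp [hy0]
      · exact (hK₁ ⟨y, hy⟩ fun h => hy0 (congrArg Subtype.val h)).1.le
    have n2 : 0 ≤ B z (K₂ ⟨z, hz⟩) := by
      by_cases hz0 : z = 0
      · simp [hz0]
      · exact (hK₂ ⟨z, hz⟩ fun h => hz0 (congrArg Subtype.val h)).1.le
    by_cases hy0 : y = 0
    · have hz0 : z ≠ 0 := by
        rintro rfl
        exact hv (by simp [hy0])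
      exact add_pos_of_nonneg_of_pos n1 (hK₂ ⟨z, hz⟩ fun h => hz0 (congrArg Subtype.val h)).1
    · exact add_pos_of_pos_of_nonneg (hK₁ ⟨y, hy⟩ fun h => hy0 (congrArg Subtype.val h)).1 n2
  · have := hK ⟨v, hv⟩ 0
    simp only [ZeroMemClass.coe_zero, add_zero, map_zero] at this
    rw [LinearMap.coe_toContinuousLinearMap', this]
    exact (K₁ _).2
  · have := hK ⟨v, hv⟩ 0
    simp only [ZeroMemClass.coe_zero, add_zero, map_zero] at this
    rw [LinearMap.coe_toContinuousLinearMap', this]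
    exact (hK₁ ⟨v, hv⟩ fun h => hv0 (congrArg Subtype.val h)).2

end TamePairs


/-! ### Top exterior powers of 2-forms -/

section PairVolume

variable {T : Type*} [AddCommGroup T] [Module ℝ T] {ι : Type*} [Fintype ι] [DecidableEq ι]

/-- The multilinear map `∏ i, β (e (i, 0)) (e (i, 1))`. -/
def pairProd (β : T →ₗ[ℝ] T →ₗ[ℝ] ℝ) : MultilinearMap ℝ (fun _ : ι × Fin 2 => T) ℝ where
  toFun e := ∏ i, β (e (i, 0)) (e (i, 1))
  map_update_add' := by
    intro inst e j x y
    obtain rfl : inst = instDecidableEqProd := Subsingleton.elim _ _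
    obtain ⟨i, ε⟩ := j
    have h : ∀ z, ∏ l, β (Function.update e (i, ε) z (l, 0)) (Function.update e (i, ε) z (l, 1)) =
        β (Function.update e (i, ε) z (i, 0)) (Function.update e (i, ε) z (i, 1)) *
          ∏ l ∈ Finset.univ.erase i, β (e (l, 0)) (e (l, 1)) := fun z => by
      rw [← Finset.mul_prod_erase _ _ (Finset.mem_univ i)]
      congr 1
      refine Finset.prod_congr rfl fun l hl => ?_
      have hl' : l ≠ i := Finset.ne_of_mem_erase hl
      simp [Function.update_of_ne, hl']
    rw [h, h, h, ← add_mul]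
    congr 1
    fin_cases ε <;> simp
  map_update_smul' := by
    intro inst e j c x
    obtain rfl : inst = instDecidableEqProd := Subsingleton.elim _ _
    obtain ⟨i, ε⟩ := j
    have h : ∀ z, ∏ l, β (Function.update e (i, ε) z (l, 0)) (Function.update e (i, ε) z (l, 1)) =
        β (Function.update e (i, ε) z (i, 0)) (Function.update e (i, ε) z (i, 1)) *
          ∏ l ∈ Finset.univ.erase i, β (e (l, 0)) (e (l, 1)) := fun z => by
      rw [← Finset.mul_prod_erase _ _ (Finset.mem_univ i)]
      congr 1
      refine Finset.prod_congr rfl fun l hl => ?_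
      have hl' : l ≠ i := Finset.ne_of_mem_erase hl
      simp [Function.update_of_ne, hl']
    rw [h, h, smul_eq_mul, ← mul_assoc]
    congr 1
    fin_cases ε <;> simp

/-- The antisymmetrization of `∏ i, β (e (i, 0)) (e (i, 1))`, which is a positive multiple of the
top exterior power of `β`. -/
def pairVolume (β : T →ₗ[ℝ] T →ₗ[ℝ] ℝ) : T [⋀^ι × Fin 2]→ₗ[ℝ] ℝ :=
  MultilinearMap.alternatization (pairProd β)

lemma pairVolume_apply (β : T →ₗ[ℝ] T →ₗ[ℝ] ℝ) (e : ι × Fin 2 → T) :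
    pairVolume β e = ∑ σ : Equiv.Perm (ι × Fin 2), ((Equiv.Perm.sign σ : ℤ) : ℝ) *
      ∏ i, β (e (σ (i, 0))) (e (σ (i, 1))) := by
  rw [pairVolume, MultilinearMap.alternatization_apply]
  refine Finset.sum_congr rfl fun σ _ => ?_
  simp [pairProd, Units.smul_def]

/-- The entries of a symplectic form in a symplectic basis. -/
def stdSymp (a b : ι × Fin 2) : ℝ :=
  if a.1 = b.1 then (if a.2 = 0 ∧ b.2 = 1 then 1 else if a.2 = 1 ∧ b.2 = 0 then -1 else 0) else 0

/-- If the product is nonzero, `σ` permutes the pairs by some `τ` and acts inside each by a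
permutation `f i`. As `τ` acts on both members of the pairs, its sign enters squared; the sign of
`σ` is `∏ sign (f i)`, which is exactly the product of the entries. -/
lemma sign_mul_prod_stdSymp_nonneg (σ : Equiv.Perm (ι × Fin 2)) :
    0 ≤ ((Equiv.Perm.sign σ : ℤ) : ℝ) * ∏ i : ι, stdSymp (σ (i, 0)) (σ (i, 1)) := by
  by_cases h0 : ∃ i, stdSymp (σ (i, 0)) (σ (i, 1)) = 0
  · obtain ⟨i, hi⟩ := h0
    rw [Finset.prod_eq_zero (Finset.mem_univ i) hi, mul_zero]
  push Not at h0
  have h1 : ∀ i, (σ (i, 0)).1 = (σ (i, 1)).1 := fun i => by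
    by_contra hne
    exact h0 i (by simp [stdSymp, hne])
  have h1' : ∀ i ε, (σ (i, ε)).1 = (σ (i, 0)).1 := fun i ε => by
    fin_cases ε
    · rfl
    · exact (h1 i).symm
  have hinj : ∀ i, Function.Injective fun ε => (σ (i, ε)).2 := fun i ε ε' h => by
    have : σ (i, ε) = σ (i, ε') := Prod.ext ((h1' i ε).trans (h1' i ε').symm) h
    exact congrArg Prod.snd (σ.injective this)
  let f : ι → Equiv.Perm (Fin 2) := fun i =>
    Equiv.ofBijective _ (Finite.injective_iff_bijective.1 (hinj i))
  have hτ : Function.Injective fun i => (σ (i, 0)).1 := fun i j h => by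
    obtain ⟨ε, hε⟩ := (f j).surjective ((σ (i, 0)).2)
    have : σ (i, 0) = σ (j, ε) := Prod.ext (h.trans (h1' j ε).symm) hε.symm
    exact congrArg Prod.fst (σ.injective this)
  let τ : Equiv.Perm ι := Equiv.ofBijective _ (Finite.injective_iff_bijective.1 hτ)
  have hσ : σ = (Equiv.prodCongrLeft fun _ : Fin 2 => τ) * Equiv.prodCongrRight f := by
    ext ⟨i, ε⟩
    · exact h1' i ε
    · rfl
  have hsign : (Equiv.Perm.sign σ : ℤ) = ∏ i, (Equiv.Perm.sign (f i) : ℤ) := by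
    rw [hσ, Equiv.Perm.sign_mul, Equiv.Perm.sign_prodCongrLeft, Equiv.Perm.sign_prodCongrRight]
    simp
  have hf : ∀ i, stdSymp (σ (i, 0)) (σ (i, 1)) = ((Equiv.Perm.sign (f i) : ℤ) : ℝ) := fun i => by
    have e0 : (σ (i, 0)).2 = f i 0 := rfl
    have e1 : (σ (i, 1)).2 = f i 1 := rfl
    rw [stdSymp, if_pos (h1 i), e0, e1]
    have hg : ∀ g : Equiv.Perm (Fin 2), (g 0 = 0 ∧ g 1 = 1 ∧ Equiv.Perm.sign g = 1) ∨
        (g 0 = 1 ∧ g 1 = 0 ∧ Equiv.Perm.sign g = -1) := by decide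
    obtain ⟨h2, h3, h4⟩ | ⟨h2, h3, h4⟩ := hg (f i) <;> simp [h2, h3, h4]
  rw [hsign, Int.cast_prod, ← Finset.prod_mul_distrib]
  refine Finset.prod_nonneg fun i _ => ?_
  rw [hf]
  exact mul_self_nonneg _

lemma pairVolume_pos_of_std {β : T →ₗ[ℝ] T →ₗ[ℝ] ℝ} {e : ι × Fin 2 → T}
    (h : ∀ a b, β (e a) (e b) = stdSymp a b) : 0 < pairVolume β e := by
  rw [pairVolume_apply]
  simp only [h]
  refine Finset.sum_pos' (fun σ _ => sign_mul_prod_stdSymp_nonneg σ)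
    ⟨1, Finset.mem_univ _, ?_⟩
  simp [stdSymp]

end PairVolume

/-! ### Symplectic bases -/

section Darboux

/-- Existence of symplectic bases. -/
lemma exists_symplectic_family (n : ℕ) {T : Type*} [AddCommGroup T] [Module ℝ T]
    [FiniteDimensional ℝ T] (hT : finrank ℝ T = 2 * n) {β : T →ₗ[ℝ] T →ₗ[ℝ] ℝ} (hβ : β.IsAlt)
    (hnd : ∀ v, (∀ w, β v w = 0) → v = 0) :
    ∃ e : Fin n × Fin 2 → T, ∀ a b, β (e a) (e b) = stdSymp a b := by
  induction n generalizing T with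
  | zero => exact ⟨fun a => a.1.elim0, fun a => a.1.elim0⟩
  | succ n ih =>
    have : Nontrivial T := Module.nontrivial_of_finrank_pos (R := ℝ) (by omega)
    obtain ⟨v, hv⟩ := exists_ne (0 : T)
    obtain ⟨w', hw'⟩ : ∃ w, β v w ≠ 0 := by
      by_contra hcon
      push Not at hcon
      exact hv (hnd v hcon)
    obtain ⟨w, hw⟩ : ∃ w, β v w = 1 := ⟨(β v w')⁻¹ • w', by simp [hw']⟩
    have hwv : β w v = -1 := by rw [← hβ.neg, hw]
    let S : Submodule ℝ T := Submodule.span ℝ {v, w}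
    let S' : Submodule ℝ T := LinearMap.BilinForm.orthogonal β S
    have hvS : v ∈ S := Submodule.subset_span (by simp)
    have hwS : w ∈ S := Submodule.subset_span (by simp)
    have hres : (LinearMap.BilinForm.restrict β S).Nondegenerate := by
      have hl : ∀ u : S, (∀ z : S, β u z = 0) → u = 0 := by
        rintro ⟨u, hu⟩ huz
        obtain ⟨a, b, rfl⟩ := Submodule.mem_span_pair.1 hu
        have h1 := huz ⟨v, hvS⟩
        have h2 := huz ⟨w, hwS⟩
        simp only [map_add, map_smul, LinearMap.add_apply, LinearMap.smul_apply, hβ.self_eq_zero,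
          hw, hwv, smul_eq_mul] at h1 h2
        have ha : a = 0 := by linarith
        have hb : b = 0 := by linarith
        exact Subtype.ext (by simp [ha, hb])
      refine ⟨hl, fun u hu => hl u fun z => ?_⟩
      rw [← hβ.neg]
      exact neg_eq_zero.2 (hu z)
    have hc : IsCompl S S' :=
      LinearMap.BilinForm.isCompl_orthogonal_of_restrict_nondegenerate hβ.isRefl hres
    have hli : LinearIndependent ℝ ![v, w] := by
      rw [LinearIndependent.pair_iff]
      intro a b hab
      have h1 := congrArg (β v) hab
      have h2 := congrArg (β w) hab
      simp only [map_add, map_smul, hβ.self_eq_zero, hw, hwv, smul_eq_mul, map_zero] at h1 h2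
      constructor <;> linarith
    have hS2 : finrank ℝ S = 2 := by
      have := finrank_span_eq_card hli
      rw [Matrix.range_cons, Matrix.range_cons, Matrix.range_empty, union_empty] at this
      exact this
    have hS' : finrank ℝ S' = 2 * n := by
      have := Submodule.finrank_add_eq_of_isCompl hc
      omega
    have hSS' : ∀ x ∈ S, ∀ y ∈ S', β x y = 0 := fun x hx y hy => hy x hx
    have hS'S : ∀ y ∈ S', ∀ x ∈ S, β y x = 0 := fun y hy x hx => by
      rw [← hβ.neg, hSS' x hx y hy, neg_zero]
    obtain ⟨e, he⟩ := ih hS' (β := β.domRestrict₁₂ S' S') (fun x => hβ x) fun y hy => by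
      refine Subtype.ext (hnd y fun z => ?_)
      obtain ⟨p, q, hp, hq, rfl⟩ := Submodule.codisjoint_iff_exists_add_eq.1 hc.codisjoint z
      rw [map_add, hS'S y y.2 p hp, zero_add]
      exact hy ⟨q, hq⟩
    have hvw : ∀ ε, ![v, w] ε ∈ S := fun ε => by fin_cases ε <;> assumption
    refine ⟨fun a => Fin.cases (![v, w] a.2) (fun i => (e (i, a.2) : T)) a.1, ?_⟩
    rintro ⟨i, ε⟩ ⟨j, δ⟩
    induction i using Fin.cases with
    | zero =>
      induction j using Fin.cases with
      | zero =>
        fin_cases ε <;> fin_cases δ <;> simp [stdSymp, hβ.self_eq_zero, hw, hwv]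
      | succ j =>
        have : stdSymp ((0 : Fin (n + 1)), ε) (j.succ, δ) = 0 := by
          simp [stdSymp, (Fin.succ_ne_zero j).symm]
        rw [this]
        exact hSS' _ (hvw ε) _ (e (j, δ)).2
    | succ i =>
      induction j using Fin.cases with
      | zero =>
        have : stdSymp (i.succ, ε) ((0 : Fin (n + 1)), δ) = 0 := by
          simp [stdSymp, Fin.succ_ne_zero i]
        rw [this]
        exact hS'S _ (e (i, ε)).2 _ (hvw δ)
      | succ j =>
        refine (he (i, ε) (j, δ)).trans ?_
        simp [stdSymp]

end Darboux

/-! ### Symplectic and complex orientations -/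

section Orientation

variable {T : Type*} [AddCommGroup T] [Module ℝ T]

/-- A top degree form vanishing on one basis is zero, but this one is positive on a symplectic
family. -/
lemma pairVolume_ne_zero {n : ℕ} {β : T →ₗ[ℝ] T →ₗ[ℝ] ℝ} (hβ : β.IsAlt)
    (hnd : ∀ v, (∀ w, β v w = 0) → v = 0) (b : Basis (Fin n × Fin 2) ℝ T) :
    pairVolume β b ≠ 0 := by
  have : FiniteDimensional ℝ T := b.finiteDimensional_of_finite
  have hT : finrank ℝ T = 2 * n := by
    rw [finrank_eq_card_basis b]; simp [mul_comm]
  obtain ⟨e, he⟩ := exists_symplectic_family n hT hβ hnd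
  intro h0
  have h1 := pairVolume_pos_of_std he
  rw [(pairVolume β).eq_smul_basis_det b, h0] at h1
  simp at h1

/-- The symplectic form whose symplectic basis is `b`. -/
def stdSympForm {ι : Type*} [Fintype ι] [DecidableEq ι] (b : Basis (ι × Fin 2) ℝ T) :
    T →ₗ[ℝ] T →ₗ[ℝ] ℝ :=
  ∑ i, ((b.coord (i, 0)).smulRight (b.coord (i, 1)) - (b.coord (i, 1)).smulRight (b.coord (i, 0)))

lemma stdSympForm_apply {ι : Type*} [Fintype ι] [DecidableEq ι] (b : Basis (ι × Fin 2) ℝ T)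
    (v w : T) : stdSympForm b v w =
      ∑ i, (b.repr v (i, 0) * b.repr w (i, 1) - b.repr v (i, 1) * b.repr w (i, 0)) := by
  simp [stdSympForm, LinearMap.sum_apply]

lemma stdSympForm_basis {ι : Type*} [Fintype ι] [DecidableEq ι] (b : Basis (ι × Fin 2) ℝ T)
    (x y : ι × Fin 2) : stdSympForm b (b x) (b y) = stdSymp x y := by
  obtain ⟨i, ε⟩ := x
  obtain ⟨j, δ⟩ := y
  rw [stdSympForm_apply]
  simp only [Basis.repr_self, Finsupp.single_apply, Prod.mk.injEq]
  rw [Finset.sum_eq_single i]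
  · by_cases hij : i = j
    · subst hij
      fin_cases ε <;> fin_cases δ <;> simp [stdSymp]
    · simp [stdSymp, hij, show j ≠ i from fun h => hij h.symm]
  · intro l _ hl
    simp [hl.symm]
  · simp

/-- A symplectic form taming a complex structure induces the complex orientation. -/
theorem pairVolume_pos_of_tame {n : ℕ} {β : T →ₗ[ℝ] T →ₗ[ℝ] ℝ} (hβ : β.IsAlt) {J : T →ₗ[ℝ] T}
    (hJ : ∀ v, J (J v) = -v) (hβJ : ∀ v, v ≠ 0 → 0 < β v (J v))
    (b : Basis (Fin n × Fin 2) ℝ T) (hb : ∀ i, b (i, 1) = J (b (i, 0))) :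
    0 < pairVolume β b := by
  have hb' : ∀ i, J (b (i, 1)) = -b (i, 0) := fun i => by rw [hb, hJ]
  let γ := stdSympForm b
  have hγ : γ.IsAlt := fun v => by
    rw [stdSympForm_apply]
    exact Finset.sum_eq_zero fun i _ => by ring
  have hrepr : ∀ v i, b.repr (J v) (i, 0) = -b.repr v (i, 1) ∧
      b.repr (J v) (i, 1) = b.repr v (i, 0) := fun v i => by
    have h1 : (b.coord (i, 0)) ∘ₗ J = -(b.coord (i, 1)) := b.ext fun ⟨j, δ⟩ => by
      fin_cases δ
      · simp [← hb]
      · simp [hb', Finsupp.single_apply]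
    have h2 : (b.coord (i, 1)) ∘ₗ J = b.coord (i, 0) := b.ext fun ⟨j, δ⟩ => by
      fin_cases δ
      · simp [← hb, Finsupp.single_apply]
      · simp [hb']
    exact ⟨LinearMap.congr_fun h1 v, LinearMap.congr_fun h2 v⟩
  have hγJ : ∀ v, v ≠ 0 → 0 < γ v (J v) := fun v hv => by
    rw [stdSympForm_apply]
    simp only [(hrepr v _).1, (hrepr v _).2]
    obtain ⟨⟨i, δ⟩, hi⟩ : ∃ x, b.repr v x ≠ 0 := by
      by_contra hcon
      push Not at hcon
      exact hv (b.repr.map_eq_zero_iff.1 (Finsupp.ext hcon))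
    refine Finset.sum_pos' (fun j _ => ?_) ⟨i, Finset.mem_univ _, ?_⟩
    · nlinarith [sq_nonneg (b.repr v (j, 0)), sq_nonneg (b.repr v (j, 1))]
    · have : 0 < b.repr v (i, δ) ^ 2 := by positivity
      have h' : b.repr v (i, δ) ^ 2 ≤ b.repr v (i, 0) ^ 2 + b.repr v (i, 1) ^ 2 := by
        fin_cases δ
        · exact le_add_of_nonneg_right (sq_nonneg _)
        · exact le_add_of_nonneg_left (sq_nonneg _)
      linarith
  -- All forms on the segment from `β` to `γ` tame `J`, hence are nondegenerate, so the volume of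
  -- `b` cannot change sign along it.
  let F : ℝ → ℝ := fun t => pairVolume ((1 - t) • β + t • γ) b
  have hF : Continuous F := by
    simp only [F, pairVolume_apply, LinearMap.add_apply, LinearMap.smul_apply]
    fun_prop
  have hF1 : 0 < F 1 := by
    have : (1 - (1 : ℝ)) • β + (1 : ℝ) • γ = γ := by simp
    simp only [F, this]
    exact pairVolume_pos_of_std (stdSympForm_basis b)
  have hFne : ∀ t ∈ Icc (0 : ℝ) 1, F t ≠ 0 := fun t ht => by
    refine pairVolume_ne_zero (fun v => by simp [hβ.self_eq_zero, hγ.self_eq_zero])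
      (fun v hv => ?_) b
    by_contra hv0
    have h1 := hβJ v hv0
    have h2 := hγJ v hv0
    have h3 := hv (J v)
    simp only [LinearMap.add_apply, LinearMap.smul_apply, smul_eq_mul] at h3
    have h4 : 0 ≤ (1 - t) * β v (J v) := mul_nonneg (by linarith [ht.2]) h1.le
    have h5 : 0 ≤ t * γ v (J v) := mul_nonneg ht.1 h2.le
    obtain ht0 | ht0 := ht.1.eq_or_lt
    · rw [← ht0] at h3
      linarith
    · have := mul_pos ht0 h2
      linarith
  have h0 : F 0 = pairVolume β b := by simp [F]
  rw [← h0]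
  by_contra hcon
  obtain ⟨t, ht, hFt⟩ := intermediate_value_Icc (zero_le_one (α := ℝ)) hF.continuousOn
    ⟨not_lt.1 hcon, hF1.le⟩
  exact hFne t ht hFt

/-- A real vector space with a complex structure `J` has a basis of the form `v, J v, …`. -/
lemma exists_complex_basis {J : T →ₗ[ℝ] T} (hJ : ∀ v, J (J v) = -v) {n : ℕ} [FiniteDimensional ℝ T]
    (hT : finrank ℝ T = 2 * n) :
    ∃ b : Basis (Fin n × Fin 2) ℝ T, ∀ i, b (i, 1) = J (b (i, 0)) := by
  -- `J` makes `T` a complex vector space; a complex basis times `1, i` is the required real basis.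
  let φ : ℂ →ₐ[ℝ] Module.End ℝ T := Complex.lift ⟨J, LinearMap.ext hJ⟩
  let _ : Module ℂ T := Module.compHom T φ.toRingHom
  have hsmul : ∀ (z : ℂ) (v : T), z • v = φ z v := fun _ _ => rfl
  have : IsScalarTower ℝ ℂ T := ⟨fun r z v => by rw [hsmul, hsmul, map_smul]; rfl⟩
  have : FiniteDimensional ℂ T := Module.Finite.of_restrictScalars_finite ℝ ℂ T
  have hn : finrank ℂ T = n := by
    have := Module.finrank_mul_finrank ℝ ℂ T
    rw [Complex.finrank_real_complex, hT] at this
    omega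
  let c : Basis (Fin n) ℂ T := finBasisOfFinrankEq ℂ T hn
  refine ⟨(Complex.basisOneI.smulTower c).reindex (Equiv.prodComm _ _), fun i => ?_⟩
  simp [Basis.smulTower_apply, hsmul, φ]

variable [TopologicalSpace T]

lemma update_pair_zero {α : Type*} (x y z : α) : Function.update ![x, y] 0 z = ![z, y] := by
  ext i; fin_cases i <;> rfl

lemma update_pair_one {α : Type*} (x y z : α) : Function.update ![x, y] 1 z = ![x, z] := by
  ext i; fin_cases i <;> rfl

/-- A continuous alternating 2-form as a bilinear form. -/
def altBilin (B : T [⋀^Fin 2]→L[ℝ] ℝ) : T →ₗ[ℝ] T →ₗ[ℝ] ℝ :=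
  LinearMap.mk₂ ℝ (fun v w => B ![v, w])
    (fun v v' w => by
      simpa only [update_pair_zero] using B.map_update_add ![v, w] 0 v v')
    (fun c v w => by
      simpa only [update_pair_zero] using B.map_update_smul ![v, w] 0 c v)
    (fun v w w' => by
      simpa only [update_pair_one] using B.map_update_add ![v, w] 1 w w')
    (fun c v w => by
      simpa only [update_pair_one] using B.map_update_smul ![v, w] 1 c w)

lemma altBilin_apply (B : T [⋀^Fin 2]→L[ℝ] ℝ) (v w : T) : altBilin B v w = B ![v, w] := rfl

lemma isAlt_altBilin (B : T [⋀^Fin 2]→L[ℝ] ℝ) : (altBilin B).IsAlt := fun v =>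
  B.map_eq_zero_of_eq ![v, v] (i := 0) (j := 1) rfl (by decide)

/-- The indices `2 i` and `2 i + 1`. -/
def pairIndex (k : ℕ) : Fin (k + 1) × Fin 2 ≃ Fin (2 * k + 2) :=
  finProdFinEquiv.trans (finCongr (by ring))

lemma pairIndex_zero (k : ℕ) (i : Fin (k + 1)) :
    pairIndex k (i, 0) = ⟨2 * (i : ℕ), by omega⟩ := by
  ext; simp [pairIndex]

lemma pairIndex_one (k : ℕ) (i : Fin (k + 1)) :
    pairIndex k (i, 1) = ⟨2 * (i : ℕ) + 1, by omega⟩ := by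
  ext; simp [pairIndex, add_comm]

lemma symplecticVolume_eq (k : ℕ) (B : T [⋀^Fin 2]→L[ℝ] ℝ) (e : Fin (2 * k + 2) → T) :
    symplecticVolume k B e = pairVolume (altBilin B) (e ∘ pairIndex k) := by
  rw [pairVolume_apply, symplecticVolume, ← (pairIndex k).permCongr.sum_comp]
  refine Finset.sum_congr rfl fun σ _ => ?_
  rw [Equiv.Perm.sign_permCongr]
  congr 1
  refine Finset.prod_congr rfl fun i _ => ?_
  rw [← pairIndex_zero, ← pairIndex_one]
  simp [altBilin_apply]

/-- A symplectic form taming a complex structure `J` induces the complex orientation. -/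
theorem isComplexPositive_iff {k : ℕ} {J : T →L[ℝ] T} (hJ : ∀ v, J (J v) = -v)
    {B : T [⋀^Fin 2]→L[ℝ] ℝ} (hB : ∀ v, v ≠ 0 → 0 < B ![v, J v])
    (hT : finrank ℝ T = 2 * k + 2) [FiniteDimensional ℝ T] (e : Fin (2 * k + 2) → T) :
    IsComplexPositive k J e ↔ 0 < symplecticVolume k B e := by
  have hpos : ∀ b : Basis (Fin (2 * k + 2)) ℝ T, (∀ i : Fin (k + 1),
      b ⟨2 * (i : ℕ) + 1, by omega⟩ = J (b ⟨2 * (i : ℕ), by omega⟩)) →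
      (0 < symplecticVolume k B e ↔ 0 < b.det e) := by
    intro b hb
    let b' := b.reindex (pairIndex k).symm
    have hb' : ∀ i, b' (i, 1) = J (b' (i, 0)) := fun i => by
      simp only [b', Basis.reindex_apply, Equiv.symm_symm, pairIndex_zero, pairIndex_one]
      exact hb i
    have h1 := pairVolume_pos_of_tame (isAlt_altBilin B) (J := J.toLinearMap) hJ hB b' hb'
    rw [symplecticVolume_eq, (pairVolume (altBilin B)).eq_smul_basis_det b']
    have h2 : b'.det (e ∘ pairIndex k) = b.det e := by
      rw [Basis.det_reindex]
      congr 1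
      ext; simp
    rw [AlternatingMap.smul_apply, smul_eq_mul, h2]
    exact mul_pos_iff_of_pos_left h1
  constructor
  · rintro ⟨b, hb, hbe⟩
    exact (hpos b hb).2 hbe
  · intro h
    obtain ⟨b, hb⟩ : ∃ b : Basis (Fin (2 * k + 2)) ℝ T, ∀ i : Fin (k + 1),
      b ⟨2 * (i : ℕ) + 1, by omega⟩ = J (b ⟨2 * (i : ℕ), by omega⟩) := by
      obtain ⟨b, hb⟩ := exists_complex_basis (J := J.toLinearMap) hJ (n := k + 1) (by omega)
      refine ⟨b.reindex (pairIndex k), fun i => ?_⟩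
      simpa [← pairIndex_zero, ← pairIndex_one] using hb i
    exact ⟨b, hb, (hpos b hb).1 h⟩

end Orientation


/-! ### Differential forms in charts -/

section FormsInCharts

variable {E : Type*} [NormedAddCommGroup E] [NormedSpace ℝ E] {H : Type*} [TopologicalSpace H]
  {I : ModelWithCorners ℝ E H} {M : Type*} [TopologicalSpace M] [ChartedSpace H M] {m : ℕ}
  [IsManifold I 1 M]

lemma DForm.eq_inChart_comp (Ω : DForm I M m) {x₀ x : M} (hx : x ∈ (extChartAt I x₀).source) :
    Ω x = (Ω.inChart x₀ (extChartAt I x₀ x)).compContinuousLinearMap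
      (mfderiv I 𝓘(ℝ, E) (extChartAt I x₀) x) := by
  ext v
  have h := mfderivWithin_extChartAt_symm_comp_mfderiv_extChartAt' (I := I) hx
  have hl : (extChartAt I x₀).symm (extChartAt I x₀ x) = x := (extChartAt I x₀).left_inv hx
  -- The point obtained by going through the chart and back equals `x` only propositionally;
  -- generalizing it to `y` allows the substitution.
  have key : ∀ (y : M) (hy : y = x) (L : E →L[ℝ] TangentSpace I y)
      (A : TangentSpace I x →L[ℝ] E), (∀ v : TangentSpace I x, (L (A v) : E) = (v : E)) →
      Ω x v = Ω y fun i => L (A (v i)) := by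
    rintro y rfl L A hLA
    congr 1
    ext i
    exact (hLA (v i)).symm
  exact key _ hl _ _ fun v => DFunLike.congr_fun h v

end FormsInCharts

/-! ### Chart independence of the exterior derivative -/

section ExteriorDerivative

variable {E : Type*} [NormedAddCommGroup E] [NormedSpace ℝ E]
  {M : Type*} [TopologicalSpace M] [ChartedSpace E M] {m : ℕ}

lemma contDiffAt_inChart {α : DForm 𝓘(ℝ, E) M m} (hα : α.IsSmooth) {x₀ : M} {y : E}
    (hy : y ∈ (extChartAt 𝓘(ℝ, E) x₀).target) : ContDiffAt ℝ ∞ (α.inChart x₀) y :=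
  (hα x₀).contDiffAt ((isOpen_extChartAt_target x₀).mem_nhds hy)

/-- The exterior derivative can be computed in any chart. -/
lemma DForm.d_eq_inChart_comp [IsManifold 𝓘(ℝ, E) ∞ M] {α : DForm 𝓘(ℝ, E) M m}
    (hα : α.IsSmooth) {x₀ x : M}
    (hx : x ∈ (extChartAt 𝓘(ℝ, E) x₀).source) :
    α.d x = (extDeriv (α.inChart x₀) (extChartAt 𝓘(ℝ, E) x₀ x)).compContinuousLinearMap
      (mfderiv 𝓘(ℝ, E) 𝓘(ℝ, E) (extChartAt 𝓘(ℝ, E) x₀) x) := by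
  have : IsManifold 𝓘(ℝ, E) 1 M := IsManifold.of_le (n := ∞) (by simp)
  let ψ := extChartAt 𝓘(ℝ, E) x
  let ψ₀ := extChartAt 𝓘(ℝ, E) x₀
  let f : E → E := ψ₀ ∘ ψ.symm
  have hrange : range 𝓘(ℝ, E) = univ := by simp
  have hxs : x ∈ ψ.source := mem_extChartAt_source x
  have hy : ψ x ∈ ψ.target := mem_extChartAt_target x
  have hfy : f (ψ x) = ψ₀ x := by simp only [f, Function.comp_apply, ψ.left_inv hxs]
  have hU : ∀ᶠ z in 𝓝 (ψ x), z ∈ ψ.target ∧ ψ.symm z ∈ ψ₀.source := by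
    have h1 : ψ.target ∈ 𝓝 (ψ x) := extChartAt_target_mem_nhds x
    have h2 : ContinuousAt ψ.symm (ψ x) := continuousAt_extChartAt_symm x
    have h3 : ψ₀.source ∈ 𝓝 (ψ.symm (ψ x)) := by
      rw [ψ.left_inv hxs]
      exact extChartAt_source_mem_nhds' hx
    filter_upwards [h1, h2 h3] with z hz hz' using ⟨hz, hz'⟩
  have hchain : ∀ z, z ∈ ψ.target → ψ.symm z ∈ ψ₀.source → ∀ v : E,
      fderiv ℝ f z v = mfderiv 𝓘(ℝ, E) 𝓘(ℝ, E) ψ₀ (ψ.symm z)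
        (mfderivWithin 𝓘(ℝ, E) 𝓘(ℝ, E) ψ.symm (range 𝓘(ℝ, E)) z v) := by
    intro z hz hz' v
    have h1 : MDifferentiableAt 𝓘(ℝ, E) 𝓘(ℝ, E) ψ.symm z := by
      have := mdifferentiableWithinAt_extChartAt_symm (I := 𝓘(ℝ, E)) hz
      rwa [hrange, mdifferentiableWithinAt_univ] at this
    have h2 : MDifferentiableAt 𝓘(ℝ, E) 𝓘(ℝ, E) ψ₀ (ψ.symm z) :=
      mdifferentiableAt_extChartAt (by simpa [ψ₀] using hz')
    have h3 := mfderiv_comp z h2 h1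
    rw [mfderiv_eq_fderiv] at h3
    rw [hrange, mfderivWithin_univ]
    exact DFunLike.congr_fun h3 v
  -- The two coordinate expressions differ by pull-back along the transition map `f`, which commutes
  -- with the exterior derivative.
  have hpull : α.inChart x =ᶠ[𝓝 (ψ x)]
      fun z => (α.inChart x₀ (f z)).compContinuousLinearMap (fderiv ℝ f z) := by
    filter_upwards [hU] with z hz
    ext v
    change α (ψ.symm z) _ = _
    rw [α.eq_inChart_comp hz.2]
    change α.inChart x₀ (f z) _ = α.inChart x₀ (f z) _
    congr 1
    ext i
    exact (hchain z hz.1 hz.2 (v i)).symm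
  have hf : ContDiffAt ℝ ∞ f (ψ x) := by
    have h1 : ContMDiffAt 𝓘(ℝ, E) 𝓘(ℝ, E) ∞ ψ.symm (ψ x) :=
      (contMDiffOn_extChartAt_symm x).contMDiffAt (extChartAt_target_mem_nhds x)
    have h2 : ContMDiffAt 𝓘(ℝ, E) 𝓘(ℝ, E) ∞ ψ₀ (ψ.symm (ψ x)) := by
      rw [ψ.left_inv hxs]
      exact contMDiffAt_extChartAt' (by simpa using hx)
    exact (h2.comp _ h1).contDiffAt
  have hω : DifferentiableAt ℝ (α.inChart x₀) (f (ψ x)) := by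
    rw [hfy]
    exact (contDiffAt_inChart hα ((extChartAt 𝓘(ℝ, E) x₀).map_source hx)).differentiableAt (by simp)
  have hd := extDeriv_pullback hω hf (by simpa using (ENat.LEInfty.out : (2 : WithTop ℕ∞) ≤ ∞))
  ext v
  change extDerivWithin (α.inChart x) (range 𝓘(ℝ, E)) (ψ x) _ = extDeriv (α.inChart x₀) (ψ₀ x) _
  rw [hrange, extDerivWithin_univ, hpull.extDeriv_eq, hd, hfy]
  change extDeriv (α.inChart x₀) (ψ₀ x) _ = _
  congr 1
  ext i
  have h1 := hchain (ψ x) hy (hU.self_of_nhds.2)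
  have h2 := mfderivWithin_extChartAt_symm_comp_mfderiv_extChartAt' (I := 𝓘(ℝ, E)) hxs
  have key : ∀ (y : M) (hy : y = x) (L : E →L[ℝ] TangentSpace 𝓘(ℝ, E) y)
      (A : TangentSpace 𝓘(ℝ, E) x →L[ℝ] E),
      (∀ v : TangentSpace 𝓘(ℝ, E) x, (L (A v) : E) = (v : E)) →
      ∀ v : TangentSpace 𝓘(ℝ, E) x, (mfderiv 𝓘(ℝ, E) 𝓘(ℝ, E) ψ₀ y (L (A v)) : E) =
        (mfderiv 𝓘(ℝ, E) 𝓘(ℝ, E) ψ₀ x v : E) := by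
    rintro y rfl L A hLA v
    congr 1
    exact hLA v
  exact (h1 _).trans
    (key _ (ψ.left_inv hxs) _ _ (fun v => DFunLike.congr_fun h2 v) (v i))

end ExteriorDerivative

/-! ### Comparison of contact forms -/

section ContactForms

lemma fin_one_eq {α : Type*} (v : Fin 1 → α) : v = ![v 0] := by
  ext i; fin_cases i; rfl

lemma one_form_apply_neg {T : Type*} [AddCommGroup T] [Module ℝ T] [TopologicalSpace T]
    (τ : T [⋀^Fin 1]→L[ℝ] ℝ) (v : T) : τ ![-v] = -τ ![v] := by
  have := τ.map_update_smul ![v] 0 (-1) v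
  have e : ∀ z, Function.update ![v] 0 z = ![z] := fun z => by ext i; fin_cases i; rfl
  simpa only [e, neg_smul, one_smul] using this

/-- A 1-form as a linear functional. -/
def oneForm {E : Type*} [NormedAddCommGroup E] [NormedSpace ℝ E] :
    (E [⋀^Fin 1]→L[ℝ] ℝ) ≃L[ℝ] (E →L[ℝ] ℝ) :=
  (ContinuousAlternatingMap.ofSubsingletonLIE (𝕜 := ℝ) (E := E) (F := ℝ)
    (i := (0 : Fin 1))).symm.toContinuousLinearEquiv

lemma oneForm_apply {E : Type*} [NormedAddCommGroup E] [NormedSpace ℝ E] (τ : E [⋀^Fin 1]→L[ℝ] ℝ)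
    (v : E) : oneForm τ v = τ ![v] := by
  change τ (fun _ => v) = _
  congr 1
  ext i; fin_cases i; rfl

lemma extDeriv_one_apply {E : Type*} [NormedAddCommGroup E] [NormedSpace ℝ E]
    {τ : E → E [⋀^Fin 1]→L[ℝ] ℝ} {y : E} (h : DifferentiableAt ℝ τ y) (v w : E) :
    extDeriv τ y ![v, w] = fderiv ℝ (fun z => τ z ![w]) y v - fderiv ℝ (fun z => τ z ![v]) y w := by
  rw [extDeriv_apply h, Fin.sum_univ_two]
  have e0 : (0 : Fin 2).removeNth ![v, w] = ![w] := by ext i; fin_cases i; rfl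
  have e1 : (1 : Fin 2).removeNth ![v, w] = ![v] := by ext i; fin_cases i; rfl
  simp [e0, e1, sub_eq_add_neg]

/-- Proportional 1-forms have proportional exterior derivatives on their kernels. -/
lemma extDeriv_smul_apply_of_ker {E : Type*} [NormedAddCommGroup E] [NormedSpace ℝ E]
    {τ η : E → E [⋀^Fin 1]→L[ℝ] ℝ} {c : E → ℝ} {y : E} (hτ : DifferentiableAt ℝ τ y)
    (hc : DifferentiableAt ℝ c y) (hη : η =ᶠ[𝓝 y] fun z => c z • τ z) {v w : E}
    (hv : τ y ![v] = 0) (hw : τ y ![w] = 0) :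
    extDeriv η y ![v, w] = c y * extDeriv τ y ![v, w] := by
  have hτv : ∀ u : E, DifferentiableAt ℝ (fun z => τ z ![u]) y := fun u => by
    simp_rw [← oneForm_apply]
    exact (oneForm.differentiableAt.comp y hτ).clm_apply (differentiableAt_const u)
  -- In `d(cτ) = dc ∧ τ + c dτ` the first term vanishes on the kernel of `τ`.
  have hd : ∀ u u', τ y ![u] = 0 → fderiv ℝ (fun z => (c z • τ z) ![u]) y u' =
      c y * fderiv ℝ (fun z => τ z ![u]) y u' := fun u u' hu => by
    have : (fun z => (c z • τ z) ![u]) = fun z => c z * τ z ![u] := by ext; simp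
    rw [this, fderiv_fun_mul hc (hτv u)]
    simp [hu]
  rw [hη.extDeriv_eq, extDeriv_one_apply (τ := fun z => c z • τ z) (hc.smul hτ),
    extDeriv_one_apply hτ, hd _ _ hv, hd _ _ hw]
  ring

variable {k : ℕ} {V : Type*} [TopologicalSpace V]
  [ChartedSpace (EuclideanSpace ℝ (Fin (2 * k + 1))) V]

lemma inChart_one_apply (α : DForm (𝓡 (2 * k + 1)) V 1) (x₀ : V)
    (y : EuclideanSpace ℝ (Fin (2 * k + 1))) (v : EuclideanSpace ℝ (Fin (2 * k + 1))) :
    α.inChart x₀ y ![v] = α ((extChartAt (𝓡 (2 * k + 1)) x₀).symm y)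
      ![mfderivWithin 𝓘(ℝ, EuclideanSpace ℝ (Fin (2 * k + 1))) (𝓡 (2 * k + 1))
        (extChartAt (𝓡 (2 * k + 1)) x₀).symm (range (𝓡 (2 * k + 1))) y v] := by
  change α _ _ = α _ _
  congr 1
  ext i; fin_cases i; rfl

variable [IsManifold (𝓡 (2 * k + 1)) ∞ V]

/-- The exterior derivatives of two contact forms are positive multiples of each other on the
contact planes. -/
lemma ContactStructure.IsContactForm.exists_d_eq {ξ : ContactStructure k V}
    {α l : DForm (𝓡 (2 * k + 1)) V 1} (hα : ξ.IsContactForm α) (hα0 : ∀ x, α x ≠ 0)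
    (hl : ξ.IsContactForm l) (x : V) :
    ∃ c : ℝ, 0 < c ∧ ∀ v ∈ ξ.plane x, ∀ w ∈ ξ.plane x, l.d x ![v, w] = c * α.d x ![v, w] := by
  have : IsManifold (𝓡 (2 * k + 1)) 1 V := IsManifold.of_le (n := ∞) (by simp)
  let ψ := extChartAt (𝓡 (2 * k + 1)) x
  let D := mfderiv (𝓡 (2 * k + 1)) 𝓘(ℝ, EuclideanSpace ℝ (Fin (2 * k + 1))) ψ x
  have hx : x ∈ ψ.source := mem_extChartAt_source x
  have hy : ψ x ∈ ψ.target := mem_extChartAt_target x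
  have hev : ∀ (β : DForm (𝓡 (2 * k + 1)) V 1) v, β x ![v] =
      β.inChart x (ψ x) ![D v] := fun β v => by
    rw [β.eq_inChart_comp hx]
    change β.inChart x (ψ x) _ = _
    congr 1
    ext i; fin_cases i; rfl
  have hker : ∀ z u, α.inChart x z ![u] = 0 ↔ l.inChart x z ![u] = 0 := fun z u => by
    rw [inChart_one_apply, inChart_one_apply, ← hα.mem_plane_iff, hl.mem_plane_iff]
  obtain ⟨r', hr'⟩ : ∃ r', α x ![r'] ≠ 0 := by
    by_contra hcon
    push Not at hcon
    refine hα0 x (ContinuousAlternatingMap.ext fun v => ?_)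
    rw [fin_one_eq v]
    exact hcon _
  let r : EuclideanSpace ℝ (Fin (2 * k + 1)) := D r'
  have hr : α.inChart x (ψ x) ![r] ≠ 0 := by rwa [← hev]
  -- Functionals with the same kernel are proportional. Evaluating on a fixed vector `r` transverse
  -- to the plane shows that the factor is differentiable.
  let c : EuclideanSpace ℝ (Fin (2 * k + 1)) → ℝ := fun z =>
    l.inChart x z ![r] / α.inChart x z ![r]
  have hdα := (contDiffAt_inChart hα.smooth hy).differentiableAt (by simp)
  have hdl := (contDiffAt_inChart hl.smooth hy).differentiableAt (by simp)
  have hαr : DifferentiableAt ℝ (fun z => α.inChart x z ![r]) (ψ x) := by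
    simp_rw [← oneForm_apply]
    exact (oneForm.differentiableAt.comp _ hdα).clm_apply (differentiableAt_const r)
  have hlr : DifferentiableAt ℝ (fun z => l.inChart x z ![r]) (ψ x) := by
    simp_rw [← oneForm_apply]
    exact (oneForm.differentiableAt.comp _ hdl).clm_apply (differentiableAt_const r)
  have hc : DifferentiableAt ℝ c (ψ x) := by
    simp only [c, div_eq_mul_inv]
    exact hlr.fun_mul (hαr.fun_inv hr)
  have hcl : l.inChart x =ᶠ[𝓝 (ψ x)] fun z => c z • α.inChart x z := by
    filter_upwards [hαr.continuousAt.eventually_ne hr] with z hz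
    refine oneForm.injective (ContinuousLinearMap.ext fun u => ?_)
    rw [map_smul, _root_.smul_apply, oneForm_apply, oneForm_apply, smul_eq_mul]
    have h1 : α.inChart x z ![u - (α.inChart x z ![u] / α.inChart x z ![r]) • r] = 0 := by
      rw [← oneForm_apply, map_sub, map_smul, oneForm_apply, oneForm_apply, smul_eq_mul]
      field_simp
      ring
    have h2 := (hker _ _).1 h1
    rw [← oneForm_apply, map_sub, map_smul, oneForm_apply, oneForm_apply, smul_eq_mul] at h2
    simp only [c]
    field_simp at h2 ⊢
    linarith
  refine ⟨c (ψ x), ?_, fun v hv w hw => ?_⟩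
  · have hs := fun v => (hα.mem_posSide_iff x v).symm.trans (hl.mem_posSide_iff x v)
    simp only [c, r, ← hev]
    -- The factor is positive because both forms have the same positive side, tested on `r'` or
    -- `-r'`.
    obtain h | h := hr'.lt_or_gt
    · have hneg : ∀ β : DForm (𝓡 (2 * k + 1)) V 1, β x ![-r'] = -β x ![r'] := fun β => by
        exact one_form_apply_neg (β x) r'
      have h1 := (hs (-r')).1 (by rw [hneg]; linarith)
      rw [hneg] at h1
      exact div_pos_of_neg_of_neg (by linarith) h
    · exact div_pos ((hs r').1 h) h
  · have hd : ∀ β : DForm (𝓡 (2 * k + 1)) V 1, β.IsSmooth →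
        β.d x ![v, w] = extDeriv (β.inChart x) (ψ x) ![D v, D w] := fun β hβ => by
      rw [β.d_eq_inChart_comp hβ hx]
      change extDeriv (β.inChart x) (ψ x) _ = _
      congr 1
      ext i; fin_cases i <;> rfl
    rw [hd l hl.smooth, hd α hα.smooth]
    exact extDeriv_smul_apply_of_ker hdα hc hcl
      (by rw [← hev]; exact (hα.mem_plane_iff x v).1 hv)
      (by rw [← hev]; exact (hα.mem_plane_iff x w).1 hw)

end ContactForms

/-! ### Local left inverses of immersions -/

section Immersions

variable {E : Type*} [NormedAddCommGroup E] [NormedSpace ℝ E] {H : Type*} [TopologicalSpace H]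
  {I : ModelWithCorners ℝ E H} {M : Type*} [TopologicalSpace M] [ChartedSpace H M]
  {E' : Type*} [NormedAddCommGroup E'] [NormedSpace ℝ E'] {H' : Type*} [TopologicalSpace H']
  {I' : ModelWithCorners ℝ E' H'} {N : Type*} [TopologicalSpace N] [ChartedSpace H' N]
  [I.Boundaryless]

/-- An immersion has local smooth left inverses. -/
lemma Manifold.IsImmersionAt.exists_leftInverse {f : M → N} {x : M}
    (h : Manifold.IsImmersionAt I I' ∞ f x) :
    ∃ r : N → M, (∀ᶠ p in 𝓝 (f x), ContMDiffAt I' I ∞ r p) ∧ ∀ᶠ z in 𝓝 x, r (f z) = z := by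
  let φ := h.domChart
  let ψ := h.codChart
  let g : E' → E := fun y => (h.equiv.symm y).1
  have hg : ContDiff ℝ ∞ g := contDiff_fst.comp h.equiv.symm.contDiff
  let r : N → M := (φ.extend I).symm ∘ g ∘ ψ.extend I'
  have hr : ∀ z ∈ φ.source, g (ψ.extend I' (f z)) = φ.extend I z := fun z hz => by
    have hz' : φ.extend I z ∈ (φ.extend I).target := (φ.extend I).map_source (by simpa using hz)
    have := h.writtenInCharts hz'
    simp only [Function.comp_apply] at this
    rw [(φ.extend_left_inv (I := I) hz)] at this
    simp only [g, φ, ψ] at this ⊢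
    rw [this]
    simp
  have hrl : ∀ z ∈ φ.source, r (f z) = z := fun z hz => by
    simp only [r, Function.comp_apply, hr z hz]
    exact φ.extend_left_inv hz
  have hx : x ∈ φ.source := h.mem_domChart_source
  refine ⟨r, ?_, Filter.eventually_of_mem (φ.open_source.mem_nhds hx) hrl⟩
  have hopen : ∀ᶠ p in 𝓝 (f x), p ∈ ψ.source ∧ g (ψ.extend I' p) ∈ (φ.extend I).target := by
    have h1 : ContinuousAt (fun p => g (ψ.extend I' p)) (f x) :=
      hg.continuous.continuousAt.comp (ψ.continuousAt_extend h.mem_codChart_source)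
    refine Filter.Eventually.and (ψ.open_source.mem_nhds h.mem_codChart_source)
      (h1.eventually_mem ?_)
    rw [hr x hx]
    exact (φ.isOpen_extend_target (I := I)).mem_nhds ((φ.extend I).map_source (by simpa using hx))
  filter_upwards [hopen] with p hp
  have h1 : ContMDiffAt I' 𝓘(ℝ, E') ∞ (ψ.extend I') p :=
    OpenPartialHomeomorph.contMDiffAt_extend h.codChart_mem_maximalAtlas hp.1
  have h2 : ContMDiffAt 𝓘(ℝ, E) I ∞ (φ.extend I).symm (g (ψ.extend I' p)) := by
    have ht : (φ.extend I).target ∈ 𝓝 (g (ψ.extend I' p)) :=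
      (φ.isOpen_extend_target (I := I)).mem_nhds hp.2
    refine (contMDiffOn_extend_symm h.domChart_mem_maximalAtlas).contMDiffAt ?_
    rwa [← φ.extend_target']
  exact ContMDiffAt.comp p (g := (φ.extend I).symm) h2 (hg.contMDiff.contMDiffAt.comp p h1)

lemma Manifold.IsImmersionAt.mfderiv_injective {f : M → N} {x : M}
    (h : Manifold.IsImmersionAt I I' ∞ f x) : Function.Injective (mfderiv I I' f x) := by
  obtain ⟨r, hr, hrf⟩ := h.exists_leftInverse
  have hf := h.contMDiffAt
  have h1 := mfderiv_comp x (hr.self_of_nhds.mdifferentiableAt (by simp))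
    (hf.mdifferentiableAt (by simp))
  have h2 : mfderiv I I (r ∘ f) x = mfderiv I I id x := Filter.EventuallyEq.mfderiv_eq hrf
  rw [h2, mfderiv_id] at h1
  have key : ∀ (y : M) (_ : y = x) (L : TangentSpace I' (f x) →L[ℝ] TangentSpace I y),
      (L ∘L mfderiv I I' f x = ContinuousLinearMap.id ℝ E) →
      Function.Injective (mfderiv I I' f x) := by
    rintro y rfl L hL v w hvw
    have := congrArg L hvw
    exact ((DFunLike.congr_fun hL v).symm.trans this).trans (DFunLike.congr_fun hL w)
  exact key _ hrf.self_of_nhds _ h1.symm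

end Immersions


/-! ### Openness of positivity -/

section Openness

variable {X : Type*} [TopologicalSpace X] {T : Type*} [NormedAddCommGroup T] [NormedSpace ℝ T]
  [FiniteDimensional ℝ T]

/-- Positive definiteness of continuous families of quadratic functions is an open condition. -/
lemma eventually_forall_pos_of_quadratic {f : X → T → ℝ} {x₀ : X}
    (hf : ∀ v, ContinuousAt (fun z : X × T => f z.1 z.2) (x₀, v))
    (hq : ∀ x (c : ℝ) v, f x (c • v) = c ^ 2 * f x v) (h0 : ∀ v ≠ 0, 0 < f x₀ v) :
    ∀ᶠ x in 𝓝 x₀, ∀ v ≠ 0, 0 < f x v := by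
  have hs : ∀ᶠ x in 𝓝 x₀, ∀ v ∈ Metric.sphere (0 : T) 1, 0 < f x v :=
    (isCompact_sphere (0 : T) 1).eventually_forall_of_forall_eventually fun v hv =>
      (hf v).eventually_const_lt (h0 v (by rintro rfl; simp at hv))
  filter_upwards [hs] with x hx v hv
  have h1 := hx (‖v‖⁻¹ • v) (by simp [norm_smul, hv])
  rw [hq] at h1
  exact pos_of_mul_pos_right h1 (by positivity)

end Openness

/-! ### Extending a tamed endomorphism to a smooth family -/

section LinearFamilies

variable {E : Type*} [NormedAddCommGroup E] [InnerProductSpace ℝ E] [FiniteDimensional ℝ E]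
  {F : Type*} [NormedAddCommGroup F] [NormedSpace ℝ F] [FiniteDimensional ℝ F]

/-- Near a point, an endomorphism that is tamed on `E` and on the image of a hyperplane can be
extended to a smooth family of endomorphisms preserving the images of a smooth family of
hyperplanes. -/
lemma exists_smooth_preserving {B : E [⋀^Fin 2]→L[ℝ] ℝ} {D : F → F →L[ℝ] E} {a : F → F →L[ℝ] ℝ}
    {δ : F → F [⋀^Fin 2]→L[ℝ] ℝ} {y₀ : F} (hD : ∀ᶠ y in 𝓝 y₀, ContDiffAt ℝ ∞ D y)
    (ha : ∀ᶠ y in 𝓝 y₀, ContDiffAt ℝ ∞ a y) (hδ : ContinuousAt δ y₀)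
    (hDi : Function.Injective (D y₀)) (ha0 : a y₀ ≠ 0)
    (hB : ∀ v, (∀ w, B ![v, w] = 0) → v = 0)
    (h : ∀ t : ℝ, 0 ≤ t → ∀ u, a y₀ u = 0 →
      (∀ u', a y₀ u' = 0 → B ![D y₀ u, D y₀ u'] + t * δ y₀ ![u, u'] = 0) → u = 0)
    (h₁ : ∀ u, a y₀ u = 0 → (∀ u', a y₀ u' = 0 → δ y₀ ![u, u'] = 0) → u = 0) :
    ∃ κ : F → E →L[ℝ] E, (∀ᶠ y in 𝓝 y₀, ContDiffAt ℝ ∞ κ y) ∧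
      (∀ v ≠ 0, 0 < B ![v, κ y₀ v]) ∧
      ∀ᶠ y in 𝓝 y₀, ∀ u ≠ 0, a y u = 0 →
        ∃ u', a y u' = 0 ∧ D y u' = κ y (D y u) ∧ 0 < δ y ![u, u'] := by
  obtain ⟨ρ, hρ⟩ : ∃ ρ, a y₀ ρ ≠ 0 := by
    by_contra! hcon
    exact ha0 (ContinuousLinearMap.ext hcon)
  obtain ⟨Λ', hΛ'⟩ := (D y₀).toLinearMap.exists_leftInverse_of_injective
    (LinearMap.ker_eq_bot.2 hDi)
  let Λ₀ : E →L[ℝ] F := LinearMap.toContinuousLinearMap Λ'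
  have hΛ₀ : ∀ u, Λ₀ (D y₀ u) = u := fun u => DFunLike.congr_fun hΛ' u
  let S : Submodule ℝ E := (a y₀).toLinearMap.ker.map (D y₀).toLinearMap
  have hS : ∀ v, v ∈ S ↔ ∃ u, a y₀ u = 0 ∧ D y₀ u = v := fun v => by simp [S]
  obtain ⟨K, hK, hKS, hK₁⟩ := exists_tame_preserving (isAlt_altBilin B)
    ((altBilin (δ y₀)).compl₁₂ Λ₀.toLinearMap Λ₀.toLinearMap) S hB
    (by
      intro t ht v hv hvw
      obtain ⟨u, hu, rfl⟩ := (hS v).1 hv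
      have := h t ht u hu fun u' hu' => by
        have := hvw _ ((hS _).2 ⟨u', hu', rfl⟩)
        simp only [LinearMap.compl₁₂_apply, ContinuousLinearMap.coe_coe, hΛ₀,
          altBilin_apply] at this
        exact this
      rw [this, map_zero])
    (by
      intro v hv hvw
      obtain ⟨u, hu, rfl⟩ := (hS v).1 hv
      have := h₁ u hu fun u' hu' => by
        have := hvw _ ((hS _).2 ⟨u', hu', rfl⟩)
        simp only [LinearMap.compl₁₂_apply, ContinuousLinearMap.coe_coe, hΛ₀,
          altBilin_apply] at this
        exact this
      rw [this, map_zero])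
  -- For `y` near `y₀`, `Λ y` is a left inverse of `D y`, `q y` projects onto `ker (a y)` along `ρ`,
  -- and `Q y` projects onto `D y (ker (a y))`. On that image `κ y` is `Q y ∘ K`, so it is
  -- preserved; at `y₀` nothing changes, as `K` already preserves `S`.
  let Λ : F → E →L[ℝ] F := fun y => Ring.inverse (Λ₀ ∘L D y) ∘L Λ₀
  let q : F → F →L[ℝ] F := fun y => .id ℝ F - (a y ρ)⁻¹ • (a y).smulRight ρ
  let Q : F → E →L[ℝ] E := fun y => D y ∘L q y ∘L Λ y
  let κ : F → E →L[ℝ] E := fun y => Q y ∘L K ∘L Q y + K ∘L (.id ℝ E - Q y)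
  have hD0 := hD.self_of_nhds
  have ha0 := ha.self_of_nhds
  have hunit : ∀ᶠ y in 𝓝 y₀, IsUnit (Λ₀ ∘L D y) := by
    have h1 : ContinuousAt (fun y => Λ₀ ∘L D y) y₀ := continuousAt_const.clm_comp hD0.continuousAt
    refine h1.eventually_mem (Units.isOpen.mem_nhds ?_)
    have : Λ₀ ∘L D y₀ = 1 := ContinuousLinearMap.ext hΛ₀
    change IsUnit _
    rw [this]
    exact isUnit_one
  have haρ : ∀ᶠ y in 𝓝 y₀, a y ρ ≠ 0 :=
    (ha0.continuousAt.clm_apply continuousAt_const).eventually_ne hρ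
  have hΛs : ∀ᶠ y in 𝓝 y₀, ContDiffAt ℝ ∞ Λ y := by
    filter_upwards [hD, hunit] with y h1 ⟨w, hw⟩
    have h2 : ContDiffAt ℝ ∞ (fun y => Λ₀ ∘L D y) y := contDiffAt_const.clm_comp h1
    have h3 := contDiffAt_ringInverse (n := ∞) ℝ w
    rw [hw] at h3
    have h4 : ContDiffAt ℝ ∞ (fun y => Ring.inverse (Λ₀ ∘L D y)) y :=
      ContDiffAt.comp (g := Ring.inverse) y h3 h2
    exact h4.clm_comp contDiffAt_const
  have hqs : ∀ᶠ y in 𝓝 y₀, ContDiffAt ℝ ∞ q y := by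
    filter_upwards [ha, haρ] with y h1 h2
    have h3 : ContDiffAt ℝ ∞ (fun y => (a y ρ)⁻¹) y := (h1.clm_apply contDiffAt_const).inv h2
    exact contDiffAt_const.sub (h3.smul (h1.smulRight contDiffAt_const))
  have hQs : ∀ᶠ y in 𝓝 y₀, ContDiffAt ℝ ∞ Q y := by
    filter_upwards [hD, hΛs, hqs] with y h1 h2 h3 using h1.clm_comp (h3.clm_comp h2)
  have hκs : ∀ᶠ y in 𝓝 y₀, ContDiffAt ℝ ∞ κ y := by
    filter_upwards [hQs] with y h1
    exact (h1.clm_comp (contDiffAt_const.clm_comp h1)).add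
      (contDiffAt_const.clm_comp (contDiffAt_const.sub h1))
  have hΛD : ∀ y, IsUnit (Λ₀ ∘L D y) → ∀ u, Λ y (D y u) = u := fun y hy u =>
    DFunLike.congr_fun (Ring.inverse_mul_cancel _ hy) u
  have haq : ∀ y, a y ρ ≠ 0 → ∀ u, a y (q y u) = 0 := fun y hy u => by
    simp only [q, _root_.sub_apply, ContinuousLinearMap.id_apply, map_sub, _root_.smul_apply,
      ContinuousLinearMap.smulRight_apply, map_smul, smul_eq_mul]
    field_simp
    ring
  have hqa : ∀ y u, a y u = 0 → q y u = u := fun y u hu => by simp [q, hu]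
  have hQS : ∀ v ∈ S, Q y₀ v = v := fun v hv => by
    obtain ⟨u, hu, rfl⟩ := (hS v).1 hv
    simp only [Q, ContinuousLinearMap.comp_apply, hΛD y₀ hunit.self_of_nhds, hqa y₀ u hu]
  have hQm : ∀ v, Q y₀ v ∈ S := fun v => (hS _).2 ⟨_, haq y₀ hρ _, rfl⟩
  have hκ0 : ∀ v, κ y₀ v = K v := fun v => by
    simp only [κ, _root_.add_apply, ContinuousLinearMap.comp_apply, _root_.sub_apply,
      ContinuousLinearMap.id_apply, hQS _ (hKS _ (hQm v)), map_sub]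
    abel
  -- The hyperplane `ker (a y)` varies, so the form is extended to all of `F`: composing with `q y`
  -- loses only the direction `ρ`, which the square `(a y u)²` detects.
  let f : F → F → ℝ := fun y u =>
    δ y ![q y u, q y (Λ y (K (D y (q y u))))] + (a y u) ^ 2
  have hpos : ∀ᶠ y in 𝓝 y₀, ∀ u ≠ 0, 0 < f y u := by
    refine eventually_forall_pos_of_quadratic (fun u => ?_) (fun y c u => ?_) fun u hu => ?_
    · have hfst : ContinuousAt Prod.fst (y₀, u) := continuousAt_fst
      have cq : ContinuousAt (fun z : F × F => q z.1) (y₀, u) :=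
        ContinuousAt.comp (g := q) (x := (y₀, u)) hqs.self_of_nhds.continuousAt hfst
      have cD' : ContinuousAt (fun z : F × F => D z.1) (y₀, u) :=
        ContinuousAt.comp (x := (y₀, u)) hD0.continuousAt hfst
      have cΛ' : ContinuousAt (fun z : F × F => Λ z.1) (y₀, u) :=
        ContinuousAt.comp (g := Λ) (x := (y₀, u)) hΛs.self_of_nhds.continuousAt hfst
      have ca : ContinuousAt (fun z : F × F => a z.1) (y₀, u) :=
        ContinuousAt.comp (x := (y₀, u)) ha0.continuousAt hfst
      have cδ : ContinuousAt (fun z : F × F => δ z.1) (y₀, u) :=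
        ContinuousAt.comp (x := (y₀, u)) hδ hfst
      have cqu := cq.clm_apply continuousAt_snd
      have cK := K.continuous.continuousAt.comp (cD'.clm_apply cqu)
      have cΛ := cq.clm_apply (cΛ'.clm_apply cK)
      have cv : ContinuousAt (fun z : F × F =>
          ![q z.1 z.2, q z.1 (Λ z.1 (K (D z.1 (q z.1 z.2))))]) (y₀, u) := by
        rw [continuousAt_pi]
        intro i
        fin_cases i
        · exact cqu
        · exact cΛ
      exact (cδ.eval cv).add ((ca.clm_apply continuousAt_snd).pow 2)
    · simp only [f, map_smul, smul_eq_mul]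
      have : ∀ v w, δ y ![c • v, c • w] = c ^ 2 * δ y ![v, w] := fun v w => by
        simp only [← altBilin_apply, map_smul, LinearMap.smul_apply, smul_eq_mul]
        ring
      rw [this]
      ring
    · simp only [f]
      obtain hq0 | hq0 := eq_or_ne (q y₀ u) 0
      · have h2 : a y₀ u ≠ 0 := fun h2 => hu ((hqa y₀ u h2).symm.trans hq0)
        have h3 := (altBilin (δ y₀)).map_zero₂ (q y₀ (Λ y₀ (K (D y₀ (0 : F)))))
        rw [altBilin_apply] at h3
        rw [hq0, h3]
        positivity
      · have hm : D y₀ (q y₀ u) ∈ S := (hS _).2 ⟨_, haq y₀ hρ u, rfl⟩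
        have h2 := hK₁ _ hm fun h3 => hq0 (hDi (h3.trans (map_zero _).symm))
        obtain ⟨u', hu', hDu'⟩ := (hS _).1 (hKS _ hm)
        rw [← hDu', hΛD y₀ hunit.self_of_nhds, hqa y₀ u' hu']
        simp only [LinearMap.compl₁₂_apply, ContinuousLinearMap.coe_coe, hΛ₀, altBilin_apply,
          ← hDu'] at h2
        positivity
  refine ⟨κ, hκs, fun v hv => ?_, ?_⟩
  · rw [hκ0]
    exact hK v hv
  · filter_upwards [hpos, hunit, haρ] with y h1 h2 h3 u hu hau
    have h4 := h1 u hu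
    simp only [f, hau, hqa y u hau] at h4
    refine ⟨q y (Λ y (K (D y u))), haq y h3 _, ?_, by simpa using h4⟩
    simp only [κ, Q, _root_.add_apply, ContinuousLinearMap.comp_apply, _root_.sub_apply,
      ContinuousLinearMap.id_apply, hΛD y h2, hqa y u hau, sub_self, map_zero, add_zero]

end LinearFamilies


/-! ### Sections of the endomorphism bundle -/

section EndomorphismSections

variable {E : Type*} [NormedAddCommGroup E] [NormedSpace ℝ E] {H : Type*} [TopologicalSpace H]
  {I : ModelWithCorners ℝ E H} {M : Type*} [TopologicalSpace M] [ChartedSpace H M]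
  [IsManifold I ∞ M]

lemma contMDiffOn_endSection_iff {p₀ : M} {s : ∀ p : M, TangentSpace I p →L[ℝ] TangentSpace I p}
    {U : Set M} (hU : IsOpen U) (hUs : U ⊆ (chartAt H p₀).source) :
    ContMDiffOn I (I.prod 𝓘(ℝ, E →L[ℝ] E)) ∞ (fun x => Bundle.TotalSpace.mk' (E →L[ℝ] E)
      (E := fun x : M => TangentSpace I x →L[ℝ] TangentSpace I x) x (s x)) U ↔
    ContMDiffOn I 𝓘(ℝ, E →L[ℝ] E) ∞ (fun p => ContinuousLinearMap.inCoordinates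
      E (TangentSpace I (M := M)) E (TangentSpace I (M := M)) p₀ p p₀ p (s p)) U := by
  refine (Bundle.Trivialization.contMDiffOn_section_iff
    (trivializationAt (E →L[ℝ] E) (fun x : M => TangentSpace I x →L[ℝ] TangentSpace I x) p₀)
    hU ?_)
  intro p hp
  rw [hom_trivializationAt_baseSet]
  exact ⟨hUs hp, hUs hp⟩

/-- The local section of the endomorphism bundle with given coordinate expression. -/
lemma exists_localSection {p₀ : M} {κ : M → E →L[ℝ] E}
    (hκ : ∀ᶠ p in 𝓝 p₀, ContMDiffAt I 𝓘(ℝ, E →L[ℝ] E) ∞ κ p) :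
    ∃ s : ∀ p : M, TangentSpace I p →L[ℝ] TangentSpace I p, ∃ U ∈ 𝓝 p₀,
      ContMDiffOn I (I.prod 𝓘(ℝ, E →L[ℝ] E)) ∞ (fun x => Bundle.TotalSpace.mk' (E →L[ℝ] E)
        (E := fun x : M => TangentSpace I x →L[ℝ] TangentSpace I x) x (s x)) U ∧
      ∀ p ∈ U, p ∈ (extChartAt I p₀).source ∧ ∀ v, mfderiv I 𝓘(ℝ, E) (extChartAt I p₀) p (s p v) =
        κ p (mfderiv I 𝓘(ℝ, E) (extChartAt I p₀) p v) := by
  let e := trivializationAt E (TangentSpace I (M := M)) p₀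
  let s : ∀ p : M, TangentSpace I p →L[ℝ] TangentSpace I p := fun p =>
    e.symmL ℝ p ∘L κ p ∘L e.continuousLinearMapAt ℝ p
  obtain ⟨U, hUκ, hUo, hUp⟩ := eventually_nhds_iff.1 hκ
  have hV : IsOpen (U ∩ (chartAt H p₀).source) := hUo.inter (chartAt H p₀).open_source
  refine ⟨s, U ∩ (chartAt H p₀).source, hV.mem_nhds ⟨hUp, mem_chart_source H p₀⟩, ?_,
    fun p hp => ⟨by simpa using hp.2, fun v => ?_⟩⟩
  · rw [contMDiffOn_endSection_iff hV inter_subset_right]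
    refine ContMDiffOn.congr (f := κ) (fun p hp => (hUκ p hp.1).contMDiffWithinAt) fun p hp => ?_
    have hb : p ∈ e.baseSet := hp.2
    ext v
    change e.continuousLinearMapAt ℝ p (e.symmL ℝ p (κ p (e.continuousLinearMapAt ℝ p
      (e.symmL ℝ p v)))) = _
    rw [e.continuousLinearMapAt_symmL hb, e.continuousLinearMapAt_symmL hb]
  · have hb : p ∈ e.baseSet := hp.2
    rw [← TangentBundle.continuousLinearMapAt_trivializationAt hp.2]
    exact e.continuousLinearMapAt_symmL hb _

variable [FiniteDimensional ℝ E]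

/-- A trivialization acts on endomorphisms by conjugation, so by `map_rotAvg` the coordinates of the
average are the average of the coordinates. -/
lemma contMDiff_rotAvg_section {K : ∀ p : M, TangentSpace I p →L[ℝ] TangentSpace I p}
    (hKs : ContMDiff I (I.prod 𝓘(ℝ, E →L[ℝ] E)) ∞ (fun x => Bundle.TotalSpace.mk' (E →L[ℝ] E)
      (E := fun x : M => TangentSpace I x →L[ℝ] TangentSpace I x) x (K x)))
    (hK : ∀ p, IsRotatable (A := E →L[ℝ] E) (K p)) :
    ContMDiff I (I.prod 𝓘(ℝ, E →L[ℝ] E)) ∞ (fun x => Bundle.TotalSpace.mk' (E →L[ℝ] E)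
      (E := fun x : M => TangentSpace I x →L[ℝ] TangentSpace I x) x
        (rotAvg (A := E →L[ℝ] E) (K x))) := by
  intro p₀
  let U := (chartAt H p₀).source
  have hU : IsOpen U := (chartAt H p₀).open_source
  have hp₀ : p₀ ∈ U := mem_chart_source H p₀
  refine ContMDiffOn.contMDiffAt ?_ (hU.mem_nhds hp₀)
  have h1 := (contMDiffOn_endSection_iff hU (subset_refl U)).1 hKs.contMDiffOn
  refine (contMDiffOn_endSection_iff (p₀ := p₀) (s := fun x => rotAvg (A := E →L[ℝ] E) (K x))
    hU (subset_refl U)).2 ?_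
  let e := trivializationAt E (TangentSpace I (M := M)) p₀
  have h2 : ∀ p ∈ U, ∃ f : (E →L[ℝ] E) →ₐ[ℝ] (E →L[ℝ] E), Continuous f ∧
      ∀ L : TangentSpace I p →L[ℝ] TangentSpace I p,
        ContinuousLinearMap.inCoordinates E (TangentSpace I (M := M)) E (TangentSpace I (M := M))
          p₀ p p₀ p L = f (show E →L[ℝ] E from L) := fun p hp => by
    let P : E ≃L[ℝ] E := e.continuousLinearEquivAt ℝ p hp
    refine ⟨P.conjContinuousAlgEquiv.toAlgEquiv.toAlgHom, P.conjContinuousAlgEquiv.continuous,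
      fun L => ?_⟩
    exact ContinuousLinearMap.inCoordinates_eq (ϕ := L) (show p ∈ e.baseSet from hp)
      (show p ∈ e.baseSet from hp)
  have h3 : ∀ p ∈ U, ContinuousLinearMap.inCoordinates E (TangentSpace I (M := M)) E
      (TangentSpace I (M := M)) p₀ p p₀ p (rotAvg (A := E →L[ℝ] E) (K p)) =
      rotAvg (ContinuousLinearMap.inCoordinates E (TangentSpace I (M := M)) E
        (TangentSpace I (M := M)) p₀ p p₀ p (K p)) := fun p hp => by
    obtain ⟨f, hfc, hf⟩ := h2 p hp
    exact ((hf _).trans (map_rotAvg (hK p) f hfc)).trans (congrArg rotAvg (hf (K p)).symm)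
  intro p hp
  obtain ⟨f, hfc, hf⟩ := h2 p hp
  have h4 : ContDiffAt ℝ ∞ rotAvg (ContinuousLinearMap.inCoordinates E (TangentSpace I (M := M)) E
      (TangentSpace I (M := M)) p₀ p p₀ p (K p)) :=
    Eq.subst (motive := fun X => ContDiffAt ℝ ∞ rotAvg X) (hf (K p)).symm
      (contDiffAt_rotAvg ((hK p).map f))
  exact ContMDiffWithinAt.congr (ContMDiffAt.comp_contMDiffWithinAt (g := rotAvg) p h4.contMDiffAt
    (h1 p hp)) h3 (h3 p hp)

end EndomorphismSections


/-! ### Evaluating forms in charts, and tamed local sections -/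

section ChartEvaluation

variable {E : Type*} [NormedAddCommGroup E] [NormedSpace ℝ E] {H : Type*} [TopologicalSpace H]
  {I : ModelWithCorners ℝ E H} {M : Type*} [TopologicalSpace M] [ChartedSpace H M]

section
variable [IsManifold I 1 M]

lemma DForm.one_apply_eq_inChart (α : DForm I M 1) {x₀ x : M} (hx : x ∈ (extChartAt I x₀).source)
    (v : TangentSpace I x) : α x ![v] =
      α.inChart x₀ (extChartAt I x₀ x) ![mfderiv I 𝓘(ℝ, E) (extChartAt I x₀) x v] := by
  rw [α.eq_inChart_comp hx]
  change α.inChart x₀ (extChartAt I x₀ x) _ = _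
  congr 1
  ext i; fin_cases i; rfl

lemma DForm.two_apply_eq_inChart (Ω : DForm I M 2) {x₀ x : M} (hx : x ∈ (extChartAt I x₀).source)
    (v w : TangentSpace I x) : Ω x ![v, w] =
      Ω.inChart x₀ (extChartAt I x₀ x) ![mfderiv I 𝓘(ℝ, E) (extChartAt I x₀) x v,
        mfderiv I 𝓘(ℝ, E) (extChartAt I x₀) x w] := by
  rw [Ω.eq_inChart_comp hx]
  change Ω.inChart x₀ (extChartAt I x₀ x) _ = _
  congr 1
  ext i; fin_cases i <;> rfl

lemma mfderiv_extChartAt_bijective {x₀ x : M} (hx : x ∈ (extChartAt I x₀).source) :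
    Function.Bijective (mfderiv I 𝓘(ℝ, E) (extChartAt I x₀) x) := by
  obtain ⟨e, he⟩ := isInvertible_mfderiv_extChartAt hx
  rw [← he]
  exact e.bijective

lemma DForm.inChart_self_two_apply (Ω : DForm I M 2) (x : M) (v w : TangentSpace I x) :
    Ω.inChart x (extChartAt I x x) ![v, w] = Ω x ![v, w] := by
  rw [Ω.two_apply_eq_inChart (mem_extChartAt_source x), mfderiv_extChartAt_self]
  rfl

end

lemma DForm.IsSmooth.continuousAt_inChart {m : ℕ} {Ω : DForm I M m} (hΩ : Ω.IsSmooth) (x : M) :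
    ContinuousAt (fun p => Ω.inChart x (extChartAt I x p)) x := by
  have h1 : ContinuousWithinAt (Ω.inChart x) (extChartAt I x).target (extChartAt I x x) :=
    (hΩ x).continuousOn _ (mem_extChartAt_target x)
  have h2 : Filter.Tendsto (extChartAt I x) (𝓝 x) (𝓝[(extChartAt I x).target] (extChartAt I x x)) :=
    tendsto_nhdsWithin_iff.2 ⟨continuousAt_extChartAt x,
      Filter.mem_of_superset (extChartAt_source_mem_nhds x) fun p hp =>
        (extChartAt I x).map_source hp⟩
  exact h1.tendsto.comp h2

lemma ContDiffAt.continuousAt_extDeriv {n : ℕ} {τ : E → E [⋀^Fin n]→L[ℝ] ℝ} {y : E}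
    (h : ContDiffAt ℝ ∞ τ y) : ContinuousAt (extDeriv τ) y :=
  (ContinuousAlternatingMap.alternatizeUncurryFinCLM ℝ E ℝ).continuous.continuousAt.comp
    (h.continuousAt_fderiv (by simp))

lemma contDiffAt_oneForm {τ : E → E [⋀^Fin 1]→L[ℝ] ℝ} {y : E} (h : ContDiffAt ℝ ∞ τ y) :
    ContDiffAt ℝ ∞ (fun z => oneForm (τ z)) y :=
  (oneForm (E := E)).comp_contDiffAt_iff.2 h

variable [IsManifold I ∞ M] [FiniteDimensional ℝ E]

/-- A local section of the endomorphism bundle that is tamed, if its coordinate expression is at the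
given point. -/
lemma exists_localSection_tame {Ω : DForm I M 2} (hΩ : Ω.IsSmooth) {p₀ : M} {κ : M → E →L[ℝ] E}
    (hκ : ∀ᶠ p in 𝓝 p₀, ContMDiffAt I 𝓘(ℝ, E →L[ℝ] E) ∞ κ p)
    (h0 : ∀ v : E, v ≠ 0 → 0 < Ω.inChart p₀ (extChartAt I p₀ p₀) ![v, κ p₀ v]) :
    ∃ s : ∀ p : M, TangentSpace I p →L[ℝ] TangentSpace I p, ∃ U ∈ 𝓝 p₀,
      ContMDiffOn I (I.prod 𝓘(ℝ, E →L[ℝ] E)) ∞ (fun x => Bundle.TotalSpace.mk' (E →L[ℝ] E)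
        (E := fun x : M => TangentSpace I x →L[ℝ] TangentSpace I x) x (s x)) U ∧
      (∀ p ∈ U, ∀ v, v ≠ 0 → 0 < Ω p ![v, s p v]) ∧
      ∀ p ∈ U, p ∈ (extChartAt I p₀).source ∧ ∀ v, mfderiv I 𝓘(ℝ, E) (extChartAt I p₀) p (s p v) =
        κ p (mfderiv I 𝓘(ℝ, E) (extChartAt I p₀) p v) := by
  have : IsManifold I 1 M := IsManifold.of_le (n := ∞) (by simp)
  obtain ⟨s, U, hU, hs, hsκ⟩ := exists_localSection hκ
  have hpos : ∀ᶠ p in 𝓝 p₀, ∀ v : E, v ≠ 0 → 0 < Ω.inChart p₀ (extChartAt I p₀ p) ![v, κ p v] := by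
    refine eventually_forall_pos_of_quadratic
      (f := fun p v => Ω.inChart p₀ (extChartAt I p₀ p) ![v, κ p v]) (fun v => ?_)
      (fun p c v => ?_) h0
    · have hfst : ContinuousAt Prod.fst (p₀, v) := continuousAt_fst
      have c1 : ContinuousAt (fun z : M × E => Ω.inChart p₀ (extChartAt I p₀ z.1)) (p₀, v) :=
        ContinuousAt.comp (g := fun p => Ω.inChart p₀ (extChartAt I p₀ p)) (x := (p₀, v))
          (hΩ.continuousAt_inChart p₀) hfst
      have c2 : ContinuousAt (fun z : M × E => κ z.1) (p₀, v) :=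
        ContinuousAt.comp (g := κ) (x := (p₀, v)) hκ.self_of_nhds.continuousAt hfst
      refine c1.eval (continuousAt_pi.2 fun i => ?_)
      fin_cases i
      · exact continuousAt_snd
      · exact c2.clm_apply continuousAt_snd
    · simp only [← altBilin_apply, map_smul, LinearMap.smul_apply, smul_eq_mul]
      ring
  refine ⟨s, U ∩ {p | ∀ v : E, v ≠ 0 → 0 < Ω.inChart p₀ (extChartAt I p₀ p) ![v, κ p v]},
    Filter.inter_mem hU hpos, hs.mono inter_subset_left, fun p hp v hv => ?_,
    fun p hp => hsκ p hp.1⟩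
  obtain ⟨h1, h2⟩ := hsκ p hp.1
  rw [Ω.two_apply_eq_inChart h1, h2]
  exact hp.2 _ fun h => hv ((mfderiv_extChartAt_bijective h1).1 (h.trans (map_zero _).symm))

end ChartEvaluation

/-! ### Positive multiples of contact forms -/

section ContactMultiples

variable {k : ℕ} {V : Type*} [TopologicalSpace V]
  [ChartedSpace (EuclideanSpace ℝ (Fin (2 * k + 1))) V]

lemma DForm.inChart_smul {E : Type*} [NormedAddCommGroup E] [NormedSpace ℝ E] {H : Type*}
    [TopologicalSpace H] {I : ModelWithCorners ℝ E H} {M : Type*} [TopologicalSpace M]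
    [ChartedSpace H M] {m : ℕ} (α : DForm I M m) (c : ℝ) (x₀ : M) :
    DForm.inChart (fun x => c • α x) x₀ = c • α.inChart x₀ :=
  rfl

/-- This turns the weak filling condition into nondegeneracy of `ω_ξ + t dα` for a fixed `α` and all
`t > 0`. -/
lemma ContactStructure.IsContactForm.const_smul {ξ : ContactStructure k V}
    {α : DForm (𝓡 (2 * k + 1)) V 1} (hα : ξ.IsContactForm α) {c : ℝ} (hc : 0 < c) :
    ξ.IsContactForm (fun x => c • α x) where
  smooth x₀ := by
    rw [DForm.inChart_smul]
    exact contDiffOn_const.smul (hα.smooth x₀)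
  mem_plane_iff x v := by
    rw [hα.mem_plane_iff]
    change _ ↔ c * α x ![v] = 0
    simp [hc.ne']
  mem_posSide_iff x v := by
    rw [hα.mem_posSide_iff]
    change _ ↔ 0 < c * α x ![v]
    simp [hc]

lemma DForm.d_smul (α : DForm (𝓡 (2 * k + 1)) V 1) (c : ℝ) (x : V) :
    DForm.d (fun x => c • α x) x = c • α.d x := by
  unfold DForm.d
  rw [DForm.inChart_smul, extDerivWithin_smul _ _ (by simp)]
  rfl

end ContactMultiples


/-! ### Local endomorphism fields at the boundary -/

section BoundarySections

variable {k : ℕ} {V : Type*} [TopologicalSpace V]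
  [ChartedSpace (EuclideanSpace ℝ (Fin (2 * k + 1))) V]
  {W : Type*} [TopologicalSpace W] [ChartedSpace (EuclideanHalfSpace (2 * k + 2)) W]

/-- An endomorphism of the tangent space of `W` at a point of `V` preserves the contact plane and is
tamed there by `dα`. -/
def IsConvexAt (ι : V → W) (ξ : ContactStructure k V) (α : DForm (𝓡 (2 * k + 1)) V 1) (x : V)
    (K : TangentSpace (𝓡∂ (2 * k + 2)) (ι x) →L[ℝ] TangentSpace (𝓡∂ (2 * k + 2)) (ι x)) : Prop :=
  ∀ v ∈ ξ.plane x, v ≠ 0 → ∃ w ∈ ξ.plane x,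
    mfderiv (𝓡 (2 * k + 1)) (𝓡∂ (2 * k + 2)) ι x w =
      K (mfderiv (𝓡 (2 * k + 1)) (𝓡∂ (2 * k + 2)) ι x v) ∧
    0 < α.d x ![v, w]

/-- A weak filling is nondegenerate on the contact planes after adding nonnegative multiples of
`dα`. -/
lemma IsWeakFilling.nondegenerateOn_add_smul {ι : V → W} {Ω : DForm (𝓡∂ (2 * k + 2)) W 2}
    {ξ : ContactStructure k V} (h : IsWeakFilling ι Ω ξ) {α : DForm (𝓡 (2 * k + 1)) V 1}
    (hα : ξ.IsContactForm α) {t : ℝ} (ht : 0 ≤ t) (x : V) :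
    NondegenerateOn (DForm.pullback (I' := 𝓡 (2 * k + 1)) ι Ω x + t • α.d x) (ξ.plane x) := by
  obtain rfl | ht := ht.eq_or_lt
  · rw [zero_smul, add_zero]
    exact h.nondegenerate x
  · rw [← DForm.d_smul]
    exact h.nondegenerate_add _ (hα.const_smul ht) x

lemma pullback_two_apply (ι : V → W) (Ω : DForm (𝓡∂ (2 * k + 2)) W 2) (x : V)
    (v w : TangentSpace (𝓡 (2 * k + 1)) x) :
    DForm.pullback (I' := 𝓡 (2 * k + 1)) ι Ω x ![v, w] =
      Ω (ι x) ![mfderiv (𝓡 (2 * k + 1)) (𝓡∂ (2 * k + 2)) ι x v,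
        mfderiv (𝓡 (2 * k + 1)) (𝓡∂ (2 * k + 2)) ι x w] := by
  change Ω (ι x) _ = _
  congr 1
  ext i; fin_cases i <;> rfl

variable [IsManifold (𝓡 (2 * k + 1)) ∞ V] [IsManifold (𝓡∂ (2 * k + 2)) ∞ W]

lemma DForm.d_apply_eq_inChart {α : DForm (𝓡 (2 * k + 1)) V 1} (hα : α.IsSmooth) {x₀ x : V}
    (hx : x ∈ (extChartAt (𝓡 (2 * k + 1)) x₀).source) (v w : TangentSpace (𝓡 (2 * k + 1)) x) :
    α.d x ![v, w] = extDeriv (α.inChart x₀) (extChartAt (𝓡 (2 * k + 1)) x₀ x)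
      ![mfderiv (𝓡 (2 * k + 1)) 𝓘(ℝ, EuclideanSpace ℝ (Fin (2 * k + 1)))
          (extChartAt (𝓡 (2 * k + 1)) x₀) x v,
        mfderiv (𝓡 (2 * k + 1)) 𝓘(ℝ, EuclideanSpace ℝ (Fin (2 * k + 1)))
          (extChartAt (𝓡 (2 * k + 1)) x₀) x w] := by
  rw [DForm.d_eq_inChart_comp hα hx]
  change extDeriv (α.inChart x₀) (extChartAt (𝓡 (2 * k + 1)) x₀ x) _ = _
  congr 1
  ext i; fin_cases i <;> rfl

lemma contDiffAt_inCharts {ι : V → W} (hι : ContMDiff (𝓡 (2 * k + 1)) (𝓡∂ (2 * k + 2)) ∞ ι)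
    {x₀ : V} {p₀ : W} {y : EuclideanSpace ℝ (Fin (2 * k + 1))}
    (hy : y ∈ (extChartAt (𝓡 (2 * k + 1)) x₀).target)
    (hp : ι ((extChartAt (𝓡 (2 * k + 1)) x₀).symm y) ∈ (extChartAt (𝓡∂ (2 * k + 2)) p₀).source) :
    ContDiffAt ℝ ∞
      (extChartAt (𝓡∂ (2 * k + 2)) p₀ ∘ ι ∘ (extChartAt (𝓡 (2 * k + 1)) x₀).symm) y := by
  have h1 : ContMDiffAt 𝓘(ℝ, EuclideanSpace ℝ (Fin (2 * k + 1))) (𝓡 (2 * k + 1)) ∞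
      (extChartAt (𝓡 (2 * k + 1)) x₀).symm y :=
    (contMDiffOn_extChartAt_symm x₀).contMDiffAt ((isOpen_extChartAt_target x₀).mem_nhds hy)
  have h2 : ContMDiffAt (𝓡∂ (2 * k + 2)) 𝓘(ℝ, EuclideanSpace ℝ (Fin (2 * k + 2))) ∞
      (extChartAt (𝓡∂ (2 * k + 2)) p₀) (ι ((extChartAt (𝓡 (2 * k + 1)) x₀).symm y)) :=
    contMDiffAt_extChartAt' (by simpa using hp)
  have h3 : ContMDiffAt 𝓘(ℝ, EuclideanSpace ℝ (Fin (2 * k + 1))) (𝓡∂ (2 * k + 2)) ∞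
      (ι ∘ (extChartAt (𝓡 (2 * k + 1)) x₀).symm) y := hι.contMDiffAt.comp y h1
  have h4 : ContMDiffAt 𝓘(ℝ, EuclideanSpace ℝ (Fin (2 * k + 1)))
      𝓘(ℝ, EuclideanSpace ℝ (Fin (2 * k + 2))) ∞
      (extChartAt (𝓡∂ (2 * k + 2)) p₀ ∘ ι ∘ (extChartAt (𝓡 (2 * k + 1)) x₀).symm) y :=
    ContMDiffAt.comp y (g := extChartAt (𝓡∂ (2 * k + 2)) p₀) h2 h3
  exact h4.contDiffAt

lemma mfderiv_inCharts_comp {ι : V → W} (hι : ContMDiff (𝓡 (2 * k + 1)) (𝓡∂ (2 * k + 2)) ∞ ι)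
    {x₀ x : V} {p₀ : W} (hx : x ∈ (extChartAt (𝓡 (2 * k + 1)) x₀).source)
    (hp : ι x ∈ (extChartAt (𝓡∂ (2 * k + 2)) p₀).source) (v : TangentSpace (𝓡 (2 * k + 1)) x) :
    mfderiv (𝓡∂ (2 * k + 2)) 𝓘(ℝ, EuclideanSpace ℝ (Fin (2 * k + 2)))
        (extChartAt (𝓡∂ (2 * k + 2)) p₀) (ι x)
        (mfderiv (𝓡 (2 * k + 1)) (𝓡∂ (2 * k + 2)) ι x v) =
      fderiv ℝ (extChartAt (𝓡∂ (2 * k + 2)) p₀ ∘ ι ∘ (extChartAt (𝓡 (2 * k + 1)) x₀).symm)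
        (extChartAt (𝓡 (2 * k + 1)) x₀ x)
        (mfderiv (𝓡 (2 * k + 1)) 𝓘(ℝ, EuclideanSpace ℝ (Fin (2 * k + 1)))
          (extChartAt (𝓡 (2 * k + 1)) x₀) x v) := by
  let ψ := extChartAt (𝓡 (2 * k + 1)) x₀
  let φ := extChartAt (𝓡∂ (2 * k + 2)) p₀
  let g : EuclideanSpace ℝ (Fin (2 * k + 1)) → EuclideanSpace ℝ (Fin (2 * k + 2)) :=
    φ ∘ ι ∘ ψ.symm
  have hψ : MDifferentiableAt (𝓡 (2 * k + 1)) 𝓘(ℝ, EuclideanSpace ℝ (Fin (2 * k + 1))) ψ x :=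
    mdifferentiableAt_extChartAt (by simpa using hx)
  have hφ : MDifferentiableAt (𝓡∂ (2 * k + 2)) 𝓘(ℝ, EuclideanSpace ℝ (Fin (2 * k + 2))) φ (ι x) :=
    mdifferentiableAt_extChartAt (by simpa using hp)
  have hιx : MDifferentiableAt (𝓡 (2 * k + 1)) (𝓡∂ (2 * k + 2)) ι x :=
    hι.mdifferentiableAt (by simp)
  have hg : ContDiffAt ℝ ∞ g (ψ x) := contDiffAt_inCharts hι (ψ.map_source hx)
    (by rwa [ψ.left_inv hx])
  have h1 : g ∘ ψ =ᶠ[𝓝 x] φ ∘ ι := by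
    filter_upwards [extChartAt_source_mem_nhds' hx] with z hz
    simp only [g, Function.comp_apply, ψ.left_inv hz]
  have h2 := mfderiv_comp x (I'' := 𝓘(ℝ, EuclideanSpace ℝ (Fin (2 * k + 2)))) (g := g)
    (hg.differentiableAt (by simp)).mdifferentiableAt hψ
  have h3 := mfderiv_comp x hφ hιx
  rw [← h1.mfderiv_eq, h2, mfderiv_eq_fderiv] at h3
  exact (DFunLike.congr_fun h3 v).symm

set_option maxHeartbeats 400000 in
/-- Near a boundary point, a weak filling has a tamed endomorphism field preserving the contact
planes and tamed there by `dα`. -/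
lemma IsWeakFilling.exists_localSection {ι : V → W} (hι : IsBoundaryIdentification (k := k) ι)
    {Ω : DForm (𝓡∂ (2 * k + 2)) W 2} (hΩ : IsSymplecticForm Ω) {ξ : ContactStructure k V}
    (h : IsWeakFilling ι Ω ξ) {α : DForm (𝓡 (2 * k + 1)) V 1}
    (hα : ξ.IsContactForm α) (hα0 : ∀ x, α x ≠ 0)
    (hαd : ∀ x, NondegenerateOn (α.d x) (ξ.plane x)) (x₀ : V) :
    ∃ s : ∀ p : W, TangentSpace (𝓡∂ (2 * k + 2)) p →L[ℝ] TangentSpace (𝓡∂ (2 * k + 2)) p,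
      ∃ U ∈ 𝓝 (ι x₀),
        ContMDiffOn (𝓡∂ (2 * k + 2)) ((𝓡∂ (2 * k + 2)).prod
          𝓘(ℝ, EuclideanSpace ℝ (Fin (2 * k + 2)) →L[ℝ] EuclideanSpace ℝ (Fin (2 * k + 2)))) ∞
          (fun x => Bundle.TotalSpace.mk'
            (EuclideanSpace ℝ (Fin (2 * k + 2)) →L[ℝ] EuclideanSpace ℝ (Fin (2 * k + 2)))
            (E := fun x : W => TangentSpace (𝓡∂ (2 * k + 2)) x →L[ℝ]
              TangentSpace (𝓡∂ (2 * k + 2)) x) x (s x)) U ∧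
        (∀ p ∈ U, ∀ v, v ≠ 0 → 0 < Ω p ![v, s p v]) ∧
        ∀ x, ι x ∈ U → IsConvexAt ι ξ α x (s (ι x)) := by
  have : IsManifold (𝓡 (2 * k + 1)) 1 V := IsManifold.of_le (n := ∞) (by simp)
  have : IsManifold (𝓡∂ (2 * k + 2)) 1 W := IsManifold.of_le (n := ∞) (by simp)
  have hιs := hι.isSmoothEmbedding.contMDiff
  have hιi := hι.isSmoothEmbedding.isImmersion.isImmersionAt x₀
  let ψ := extChartAt (𝓡 (2 * k + 1)) x₀
  let φ := extChartAt (𝓡∂ (2 * k + 2)) (ι x₀)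
  let g : EuclideanSpace ℝ (Fin (2 * k + 1)) → EuclideanSpace ℝ (Fin (2 * k + 2)) :=
    φ ∘ ι ∘ ψ.symm
  let a : EuclideanSpace ℝ (Fin (2 * k + 1)) → EuclideanSpace ℝ (Fin (2 * k + 1)) →L[ℝ] ℝ :=
    fun y => oneForm (α.inChart x₀ y)
  have hx₀ : x₀ ∈ ψ.source := mem_extChartAt_source x₀
  have hp₀ : ι x₀ ∈ φ.source := mem_extChartAt_source (ι x₀)
  have hy₀ : ψ x₀ ∈ ψ.target := mem_extChartAt_target x₀
  -- A chart has identity derivative at its own centre, so at `x₀` the coordinate data coincide with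
  -- the intrinsic ones.
  have hC : ∀ v : TangentSpace (𝓡 (2 * k + 1)) x₀,
      mfderiv (𝓡 (2 * k + 1)) 𝓘(ℝ, EuclideanSpace ℝ (Fin (2 * k + 1))) ψ x₀ v = v := fun v => by
    simp only [ψ, mfderiv_extChartAt_self]
    rfl
  have hD₀ : ∀ v : EuclideanSpace ℝ (Fin (2 * k + 1)), fderiv ℝ g (ψ x₀) v =
      mfderiv (𝓡 (2 * k + 1)) (𝓡∂ (2 * k + 2)) ι x₀ v := fun v => by
    have h1 := mfderiv_inCharts_comp hιs hx₀ hp₀ v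
    rw [mfderiv_extChartAt_self] at h1
    exact ((congrArg (fderiv ℝ g (ψ x₀)) (hC v)).symm.trans h1.symm)
  have ha₀ : ∀ v : EuclideanSpace ℝ (Fin (2 * k + 1)), a (ψ x₀) v = 0 ↔ v ∈ ξ.plane x₀ :=
    fun v => by
    refine Iff.trans ?_ (hα.mem_plane_iff x₀ v).symm
    have h1 := α.one_apply_eq_inChart hx₀ v
    have h2 : a (ψ x₀) v = α x₀ ![v] := by
      rw [h1]
      simp only [a, oneForm_apply]
      exact congrArg (fun z => α.inChart x₀ (ψ x₀) ![z]) (hC v).symm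
    rw [h2]
  have hδ₀ : ∀ v w : EuclideanSpace ℝ (Fin (2 * k + 1)),
      extDeriv (α.inChart x₀) (ψ x₀) ![v, w] = α.d x₀ ![v, w] := fun v w => by
    rw [DForm.d_apply_eq_inChart hα.smooth hx₀ v w]
    exact congrArg₂ (fun z z' => extDeriv (α.inChart x₀) (ψ x₀) ![z, z']) (hC v).symm (hC w).symm
  have hgs : ∀ᶠ y in 𝓝 (ψ x₀), ContDiffAt ℝ ∞ g y := by
    have h1 : ContinuousAt (ι ∘ ψ.symm) (ψ x₀) :=
      ContinuousAt.comp hιs.continuous.continuousAt (continuousAt_extChartAt_symm x₀)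
    have h2 : φ.source ∈ 𝓝 ((ι ∘ ψ.symm) (ψ x₀)) := by
      rw [Function.comp_apply, ψ.left_inv hx₀]
      exact extChartAt_source_mem_nhds (ι x₀)
    filter_upwards [(isOpen_extChartAt_target x₀).mem_nhds hy₀, h1 h2] with y h3 h4
    exact contDiffAt_inCharts hιs h3 h4
  have hBD : ∀ v w : EuclideanSpace ℝ (Fin (2 * k + 1)),
      Ω.inChart (ι x₀) (φ (ι x₀)) ![fderiv ℝ g (ψ x₀) v, fderiv ℝ g (ψ x₀) w] =
        DForm.pullback (I' := 𝓡 (2 * k + 1)) ι Ω x₀ ![v, w] := fun v w => by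
    rw [pullback_two_apply ι Ω x₀ v w, hD₀, hD₀]
    exact Ω.inChart_self_two_apply (ι x₀) _ _
  have hDs : ∀ᶠ y in 𝓝 (ψ x₀), ContDiffAt ℝ ∞ (fderiv ℝ g) y :=
    hgs.mono fun y hy => hy.fderiv_right (by simp)
  have has : ∀ᶠ y in 𝓝 (ψ x₀), ContDiffAt ℝ ∞ a y := by
    filter_upwards [(isOpen_extChartAt_target x₀).mem_nhds hy₀] with y hy
    exact contDiffAt_oneForm (contDiffAt_inChart hα.smooth hy)
  have hDi : Function.Injective (fderiv ℝ g (ψ x₀)) := fun v w hvw =>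
    hιi.mfderiv_injective (((hD₀ v).symm.trans hvw).trans (hD₀ w))
  have ha0 : a (ψ x₀) ≠ 0 := fun ha => hα0 x₀ (ContinuousAlternatingMap.ext fun v => by
    rw [fin_one_eq v]
    exact (hα.mem_plane_iff x₀ (v 0)).1 ((ha₀ (v 0)).1 (by rw [ha]; rfl)))
  have hBn : ∀ v, (∀ w, Ω.inChart (ι x₀) (φ (ι x₀)) ![v, w] = 0) → v = 0 := fun v hv =>
    hΩ.nondegenerate (ι x₀) v trivial fun w _ =>
      (Ω.inChart_self_two_apply (ι x₀) v w).symm.trans (hv w)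
  have hBt : ∀ t : ℝ, 0 ≤ t → ∀ u, a (ψ x₀) u = 0 → (∀ u', a (ψ x₀) u' = 0 →
      Ω.inChart (ι x₀) (φ (ι x₀)) ![fderiv ℝ g (ψ x₀) u, fderiv ℝ g (ψ x₀) u'] +
        t * extDeriv (α.inChart x₀) (ψ x₀) ![u, u'] = 0) → u = 0 := fun t ht u hu hu' =>
    h.nondegenerateOn_add_smul hα ht x₀ u ((ha₀ u).1 hu) fun w hw =>
      (congrArg₂ (fun b d => b + t * d) (hBD u w) (hδ₀ u w)).symm.trans (hu' w ((ha₀ w).2 hw))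
  have hδn : ∀ u, a (ψ x₀) u = 0 → (∀ u', a (ψ x₀) u' = 0 →
      extDeriv (α.inChart x₀) (ψ x₀) ![u, u'] = 0) → u = 0 := fun u hu hu' =>
    hαd x₀ u ((ha₀ u).1 hu) fun w hw => (hδ₀ u w).symm.trans (hu' w ((ha₀ w).2 hw))
  obtain ⟨κ, hκs, hκ0, hκ⟩ := exists_smooth_preserving hDs has
    (contDiffAt_inChart hα.smooth hy₀).continuousAt_extDeriv hDi ha0 hBn hBt hδn
  obtain ⟨r, hr, hrι⟩ := hιi.exists_leftInverse
  have hr₀ : r (ι x₀) = x₀ := hrι.self_of_nhds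
  have hrc : Filter.Tendsto r (𝓝 (ι x₀)) (𝓝 x₀) := by
    have h1 : ContinuousAt r (ι x₀) := hr.self_of_nhds.continuousAt
    rwa [ContinuousAt, hr₀] at h1
  have hψc : Filter.Tendsto ψ (𝓝 x₀) (𝓝 (ψ x₀)) := continuousAt_extChartAt x₀
  -- The family `κ` is parametrized by coordinates on `V`; the left inverse `r` of `ι` extends it to
  -- a neighbourhood in `W`.
  obtain ⟨s, U, hU, hs, hst, hsκ⟩ := exists_localSection_tame hΩ.smooth
    (p₀ := ι x₀) (κ := fun p => κ (ψ (r p)))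
    (by
      filter_upwards [hr, (hψc.comp hrc).eventually hκs,
        hrc.eventually_mem (extChartAt_source_mem_nhds (I := 𝓡 (2 * k + 1)) x₀)] with p h1 h2 h3
      have h4 : ContMDiffAt (𝓡 (2 * k + 1)) 𝓘(ℝ, EuclideanSpace ℝ (Fin (2 * k + 1))) ∞ ψ (r p) :=
        contMDiffAt_extChartAt' (by simpa using h3)
      exact ContMDiffAt.comp p (g := κ) h2.contMDiffAt (ContMDiffAt.comp p (g := ψ) h4 h1))
    (fun v hv => by
      simp only [hr₀]
      exact hκ0 v hv)
  have hnear : ∀ᶠ p in 𝓝 (ι x₀), ∀ x, ι x = p → x ∈ ψ.source ∧ r (ι x) = x ∧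
      ∀ u ≠ 0, a (ψ x) u = 0 → ∃ u', a (ψ x) u' = 0 ∧
        fderiv ℝ g (ψ x) u' = κ (ψ x) (fderiv ℝ g (ψ x) u) ∧
        0 < extDeriv (α.inChart x₀) (ψ x) ![u, u'] := by
    -- As `ι` is a topological embedding, any point of `V` whose image is near `ι x₀` is itself near
    -- `x₀`.
    rw [← Filter.eventually_comap, ← hι.isSmoothEmbedding.isEmbedding.isInducing.nhds_eq_comap]
    filter_upwards [extChartAt_source_mem_nhds (I := 𝓡 (2 * k + 1)) x₀, hrι,
      hψc.eventually hκ] with x h1 h2 h3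
    exact ⟨h1, h2, h3⟩
  refine ⟨s, U ∩ _, Filter.inter_mem hU hnear, hs.mono inter_subset_left,
    fun p hp => hst p hp.1, fun x hx v hv hv0 => ?_⟩
  obtain ⟨h1, h2, h3⟩ := hx.2 x rfl
  obtain ⟨h4, h5⟩ := hsκ _ hx.1
  have hCb := mfderiv_extChartAt_bijective h1
  have hax : ∀ v : TangentSpace (𝓡 (2 * k + 1)) x, v ∈ ξ.plane x ↔ a (ψ x)
      (mfderiv (𝓡 (2 * k + 1)) 𝓘(ℝ, EuclideanSpace ℝ (Fin (2 * k + 1))) ψ x v) = 0 := fun v => by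
    rw [hα.mem_plane_iff, α.one_apply_eq_inChart h1]
    exact Eq.congr_left (oneForm_apply (α.inChart x₀ (ψ x)) _).symm
  obtain ⟨u', hu', hDu', hpos⟩ := h3 _
    (fun h => hv0 (hCb.1 (h.trans (map_zero _).symm))) ((hax v).1 hv)
  obtain ⟨w, rfl⟩ := hCb.2 u'
  refine ⟨w, (hax w).2 hu', ?_, ?_⟩
  · refine (mfderiv_extChartAt_bijective h4).1 ?_
    rw [h5, mfderiv_inCharts_comp hιs h1 h4, mfderiv_inCharts_comp hιs h1 h4, h2]
    exact hDu'
  · rw [DForm.d_apply_eq_inChart hα.smooth h1]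
    exact hpos

end BoundarySections


/-! ### Invariant subspaces and complex tangencies -/

section LinearAlgebra

variable {E : Type*} [NormedAddCommGroup E] [NormedSpace ℝ E] [FiniteDimensional ℝ E]
  {F : Type*} [NormedAddCommGroup F] [NormedSpace ℝ F]

/-- The rotation average preserves invariant subspaces on which the endomorphism is tamed, and stays
tamed there. -/
lemma rotAvg_exists_pos {K : E →L[ℝ] E} (hK : IsRotatable K) {L : F →L[ℝ] E}
    (hL : Function.Injective L) {P : Submodule ℝ F} {δ : F [⋀^Fin 2]→L[ℝ] ℝ}
    (h : ∀ v ∈ P, v ≠ 0 → ∃ w ∈ P, L w = K (L v) ∧ 0 < δ ![v, w]) :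
    ∀ v ∈ P, v ≠ 0 → ∃ w ∈ P, L w = rotAvg K (L v) ∧ 0 < δ ![v, w] := by
  -- `Λ` carries `δ` to an alternating form on `E`, so that `rotAvg_tame` applies to the image of
  -- `P`.
  obtain ⟨Λ, hΛ⟩ := L.toLinearMap.exists_leftInverse_of_injective (LinearMap.ker_eq_bot.2 hL)
  have hΛL : ∀ u, Λ (L u) = u := fun u => DFunLike.congr_fun hΛ u
  let S : Submodule ℝ E := P.map L.toLinearMap
  have hS : ∀ v, v ∈ S ↔ ∃ u ∈ P, L u = v := fun v => by simp [S]
  have hKS : ∀ v ∈ S, K v ∈ S := fun v hv => by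
    obtain ⟨u, hu, rfl⟩ := (hS v).1 hv
    obtain rfl | hu0 := eq_or_ne u 0
    · simp
    · obtain ⟨w, hw, hwK, -⟩ := h u hu hu0
      exact (hS _).2 ⟨w, hw, hwK⟩
  have hB : ((altBilin δ).compl₁₂ Λ Λ).IsAlt := fun v => isAlt_altBilin δ (Λ v)
  have hpos : ∀ v ∈ S, v ≠ 0 → 0 < (altBilin δ).compl₁₂ Λ Λ v (K v) := fun v hv hv0 => by
    obtain ⟨u, hu, rfl⟩ := (hS v).1 hv
    obtain ⟨w, hw, hwK, hp⟩ := h u hu (by rintro rfl; simp at hv0)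
    rw [LinearMap.compl₁₂_apply, ← hwK, hΛL, hΛL]
    exact hp
  intro v hv hv0
  have hvS : L v ∈ S := (hS _).2 ⟨v, hv, rfl⟩
  obtain ⟨w, hw, hwJ⟩ := (hS _).1 (rotAvg_apply_mem hK hKS hvS)
  have h1 := rotAvg_tame hK hKS hB hpos hvS fun h0 => hv0 (hL (h0.trans (map_zero L).symm))
  rw [LinearMap.compl₁₂_apply, ← hwJ, hΛL, hΛL] at h1
  exact ⟨w, hw, hwJ, h1⟩

end LinearAlgebra

/-- If the image of a hyperplane is invariant under a complex structure, it consists of the complex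
tangencies of the image of the whole space. -/
lemma map_eq_range_inf_map {E F : Type*} [AddCommGroup E] [Module ℝ E] [AddCommGroup F] [Module ℝ F]
    {L : F →ₗ[ℝ] E} {J : E →ₗ[ℝ] E} (hJ : ∀ v, J (J v) = -v) {P : Submodule ℝ F} {a : F →ₗ[ℝ] ℝ}
    (ha : ∀ v, v ∈ P ↔ a v = 0) (h : ∀ v ∈ P, ∃ w ∈ P, L w = J (L v)) :
    P.map L = L.range ⊓ L.range.map J := by
  apply le_antisymm
  · rintro _ ⟨v, hv, rfl⟩
    refine ⟨⟨v, rfl⟩, ?_⟩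
    obtain ⟨w, -, hw'⟩ := h v hv
    refine ⟨L (-w), ⟨_, rfl⟩, ?_⟩
    rw [map_neg, map_neg, hw', hJ, neg_neg]
  · rintro _ ⟨⟨x, rfl⟩, ⟨_, ⟨y, rfl⟩, hy⟩⟩
    by_cases hx : a x = 0
    · exact ⟨x, (ha x).2 hx, rfl⟩
    -- Here `L x = J (L y)`. The image of `P` contains `L y - c L x` and, by invariance, `J` of it,
    -- which is `L x + c L y`. Eliminating `L y` leaves `(1 + c²) L x`.
    · let c := a y / a x
      have hp : y - c • x ∈ P := (ha _).2 (by simp [c, hx])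
      obtain ⟨w, hw, hwJ⟩ := h _ hp
      have h1 : J (L x) = -L y := by rw [← hy, hJ]
      have h2 : (1 + c ^ 2) • L x = L (w - c • (y - c • x)) := by
        have h3 : L w = L x + c • L y := by
          rw [hwJ, map_sub, map_sub, map_smul, map_smul, hy, h1, smul_neg, sub_neg_eq_add]
        simp only [map_sub, map_smul, h3, smul_sub, smul_smul, add_smul, one_smul]
        rw [show c ^ 2 = c * c from sq c]
        abel
      have h4 : (1 + c ^ 2) ≠ 0 := by positivity
      refine ⟨(1 + c ^ 2)⁻¹ • (w - c • (y - c • x)),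
        P.smul_mem _ (P.sub_mem hw (P.smul_mem _ hp)), ?_⟩
      rw [map_smul, ← h2, inv_smul_smul₀ h4]

/-! ### Gluing, and both directions of the equivalence -/

section Assembly

variable {k : ℕ} {V : Type*} [TopologicalSpace V]
  [ChartedSpace (EuclideanSpace ℝ (Fin (2 * k + 1))) V]
  {W : Type*} [TopologicalSpace W] [ChartedSpace (EuclideanHalfSpace (2 * k + 2)) W]

/-- The endomorphisms of a tangent space of `W` tamed by `Ω` which, at boundary points, preserve
the contact plane and are tamed there by `dα`. -/
def convexTame (ι : V → W) (Ω : DForm (𝓡∂ (2 * k + 2)) W 2) (ξ : ContactStructure k V)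
    (α : DForm (𝓡 (2 * k + 1)) V 1) (p : W) :
    Set (TangentSpace (𝓡∂ (2 * k + 2)) p →L[ℝ] TangentSpace (𝓡∂ (2 * k + 2)) p) :=
  {K | (∀ v, v ≠ 0 → 0 < Ω p ![v, K v]) ∧ ∀ (x : V) (hx : p = ι x), IsConvexAt ι ξ α x (hx ▸ K)}

/-- Invariance of the plane and the positivity conditions pass to convex combinations of `K`; this
is why `K² = -1` is not part of the definition. -/
lemma convex_convexTame (ι : V → W) (Ω : DForm (𝓡∂ (2 * k + 2)) W 2) (ξ : ContactStructure k V)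
    (α : DForm (𝓡 (2 * k + 1)) V 1) (p : W) : Convex ℝ (convexTame ι Ω ξ α p) := by
  have hlin : ∀ {T : Type} [AddCommGroup T] [Module ℝ T] [TopologicalSpace T]
      (B : T [⋀^Fin 2]→L[ℝ] ℝ) (a b : ℝ) (v w w' : T),
      B ![v, a • w + b • w'] = a * B ![v, w] + b * B ![v, w'] := by
    intro T _ _ _ B a b v w w'
    simp only [← altBilin_apply, map_add, map_smul, smul_eq_mul]
  have hpos : ∀ {a b x y : ℝ}, 0 ≤ a → 0 ≤ b → a + b = 1 → 0 < x → 0 < y → 0 < a * x + b * y := by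
    intro a b x y ha hb hab hx hy
    obtain rfl | ha := ha.eq_or_lt
    · obtain rfl : b = 1 := by linarith
      simpa using hy
    · positivity
  rintro K ⟨hK, hKc⟩ K' ⟨hK', hKc'⟩ a b ha hb hab
  refine ⟨fun v hv => ?_, ?_⟩
  · exact (hpos ha hb hab (hK v hv) (hK' v hv)).trans_eq (hlin (Ω p) a b v (K v) (K' v)).symm
  · rintro x rfl v hv hv0
    obtain ⟨w, hw, hwK, hwp⟩ := hKc x rfl v hv hv0
    obtain ⟨w', hw', hwK', hwp'⟩ := hKc' x rfl v hv hv0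
    refine ⟨a • w + b • w', add_mem (Submodule.smul_mem _ _ hw) (Submodule.smul_mem _ _ hw'), ?_,
      (hpos ha hb hab hwp hwp').trans_eq (hlin (α.d x) a b v w w').symm⟩
    rw [map_add, map_smul, map_smul, hwK, hwK']
    rfl

lemma isOrientedBoundary_iff {ι : V → W} {ξ : ContactStructure k V}
    {Ω : DForm (𝓡∂ (2 * k + 2)) W 2}
    {J : ∀ p : W, TangentSpace (𝓡∂ (2 * k + 2)) p →L[ℝ] TangentSpace (𝓡∂ (2 * k + 2)) p}
    (hJ : ∀ p v, J p (J p v) = -v) (hJΩ : IsTamedBy J Ω) :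
    IsOrientedBoundary ι ξ (fun p e => IsComplexPositive k (J p) e) ↔
      IsOrientedBoundary ι ξ fun p e => 0 < symplecticVolume k (Ω p) e := by
  have h : ∀ p e, IsComplexPositive k (J p) e ↔ 0 < symplecticVolume k (Ω p) e := fun p e => by
    have : FiniteDimensional ℝ (TangentSpace (𝓡∂ (2 * k + 2)) p) :=
      inferInstanceAs (FiniteDimensional ℝ (EuclideanSpace ℝ (Fin (2 * k + 2))))
    exact isComplexPositive_iff (hJ p) (hJΩ p)
      (finrank_euclideanSpace_fin (𝕜 := ℝ) (n := 2 * k + 2)) e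
  simp only [h]

lemma IsBoundaryIdentification.mfderiv_injective {ι : V → W}
    (hι : IsBoundaryIdentification (k := k) ι) (x : V) :
    Function.Injective (mfderiv (𝓡 (2 * k + 1)) (𝓡∂ (2 * k + 2)) ι x) :=
  (hι.isSmoothEmbedding.isImmersion.isImmersionAt x).mfderiv_injective

/-- For `0 ≠ v ∈ ξ` the vector `w = J v` lies in `ξ` and pairs positively with `v` under both `ω`
and `dl`, so neither `ω_ξ` nor the sum degenerates. -/
lemma IsTamedPseudoconvexBoundary.isWeakFilling {ι : V → W}
    (hι : IsBoundaryIdentification (k := k) ι) {Ω : DForm (𝓡∂ (2 * k + 2)) W 2}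
    {ξ : ContactStructure k V}
    {J : ∀ p : W, TangentSpace (𝓡∂ (2 * k + 2)) p →L[ℝ] TangentSpace (𝓡∂ (2 * k + 2)) p}
    (hJ : ∀ p v, J p (J p v) = -v) (hJΩ : IsTamedBy J Ω)
    (h : IsTamedPseudoconvexBoundary ι J ξ) : IsWeakFilling ι Ω ξ := by
  obtain ⟨α, hα, hα0, hαp, hαs, hαd⟩ := ξ.exists_form
  have hpos : ∀ l, ξ.IsContactForm l → ∀ x, ∀ v ∈ ξ.plane x, v ≠ 0 → ∃ w ∈ ξ.plane x,
      0 < DForm.pullback (I' := 𝓡 (2 * k + 1)) ι Ω x ![v, w] ∧ 0 < l.d x ![v, w] := by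
    intro l hl x v hv hv0
    obtain ⟨w, hw, hwJ, hp⟩ := h.convex l hl x v hv hv0
    refine ⟨w, hw, ?_, hp⟩
    rw [pullback_two_apply, hwJ]
    exact hJΩ _ _ fun h0 => hv0 (hι.mfderiv_injective x (h0.trans (map_zero _).symm))
  refine ⟨(isOrientedBoundary_iff hJ hJΩ).1 h.oriented, fun x v hv hvw => ?_,
    fun l hl x v hv hvw => ?_⟩
  · by_contra hv0
    obtain ⟨w, hw, h1, -⟩ := hpos α ⟨hα, hαp, hαs⟩ x v hv hv0
    exact h1.ne' (hvw w hw)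
  · by_contra hv0
    obtain ⟨w, hw, h1, h2⟩ := hpos l hl x v hv hv0
    exact (add_pos h1 h2).ne' (hvw w hw)

variable [IsManifold (𝓡 (2 * k + 1)) ∞ V] [IsManifold (𝓡∂ (2 * k + 2)) ∞ W]

/-- Every symplectic form tames an endomorphism field near a given point. -/
lemma IsSymplecticForm.exists_localSection {Ω : DForm (𝓡∂ (2 * k + 2)) W 2}
    (hΩ : IsSymplecticForm Ω) (p₀ : W) :
    ∃ s : ∀ p : W, TangentSpace (𝓡∂ (2 * k + 2)) p →L[ℝ] TangentSpace (𝓡∂ (2 * k + 2)) p,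
      ∃ U ∈ 𝓝 p₀,
        ContMDiffOn (𝓡∂ (2 * k + 2)) ((𝓡∂ (2 * k + 2)).prod
          𝓘(ℝ, EuclideanSpace ℝ (Fin (2 * k + 2)) →L[ℝ] EuclideanSpace ℝ (Fin (2 * k + 2)))) ∞
          (fun x => Bundle.TotalSpace.mk'
            (EuclideanSpace ℝ (Fin (2 * k + 2)) →L[ℝ] EuclideanSpace ℝ (Fin (2 * k + 2)))
            (E := fun x : W => TangentSpace (𝓡∂ (2 * k + 2)) x →L[ℝ]
              TangentSpace (𝓡∂ (2 * k + 2)) x) x (s x)) U ∧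
        ∀ p ∈ U, ∀ v, v ≠ 0 → 0 < Ω p ![v, s p v] := by
  have : IsManifold (𝓡∂ (2 * k + 2)) 1 W := IsManifold.of_le (n := ∞) (by simp)
  -- With `S = ⊥` only tameness by `Ω` remains; `K` is then kept constant in the chart.
  obtain ⟨K, hK, -⟩ := exists_tame_preserving
    (isAlt_altBilin (Ω.inChart p₀ (extChartAt (𝓡∂ (2 * k + 2)) p₀ p₀))) 0 ⊥
    (fun v hv => hΩ.nondegenerate p₀ v trivial fun w _ =>
      (Ω.inChart_self_two_apply p₀ v w).symm.trans (hv w))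
    (fun _ _ v hv _ => (Submodule.mem_bot ℝ).1 hv) (fun v hv _ => (Submodule.mem_bot ℝ).1 hv)
  obtain ⟨s, U, hU, hs, hst, -⟩ := exists_localSection_tame hΩ.smooth (p₀ := p₀)
    (κ := fun _ => K) (Filter.Eventually.of_forall fun _ => contMDiffAt_const) hK
  exact ⟨s, U, hU, hs, hst⟩

variable [CompactSpace V] [T2Space W] [CompactSpace W]

/-- On a weak filling there is a tamed endomorphism field preserving the contact planes and tamed
there by `dα`. -/
lemma IsWeakFilling.exists_convexTame {ι : V → W} (hι : IsBoundaryIdentification (k := k) ι)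
    {Ω : DForm (𝓡∂ (2 * k + 2)) W 2} (hΩ : IsSymplecticForm Ω) {ξ : ContactStructure k V}
    (h : IsWeakFilling ι Ω ξ) {α : DForm (𝓡 (2 * k + 1)) V 1}
    (hα : ξ.IsContactForm α) (hα0 : ∀ x, α x ≠ 0)
    (hαd : ∀ x, NondegenerateOn (α.d x) (ξ.plane x)) :
    ∃ K : ∀ p : W, TangentSpace (𝓡∂ (2 * k + 2)) p →L[ℝ] TangentSpace (𝓡∂ (2 * k + 2)) p,
      ContMDiff (𝓡∂ (2 * k + 2)) ((𝓡∂ (2 * k + 2)).prod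
          𝓘(ℝ, EuclideanSpace ℝ (Fin (2 * k + 2)) →L[ℝ] EuclideanSpace ℝ (Fin (2 * k + 2)))) ∞
          (fun x => Bundle.TotalSpace.mk'
            (EuclideanSpace ℝ (Fin (2 * k + 2)) →L[ℝ] EuclideanSpace ℝ (Fin (2 * k + 2)))
            (E := fun x : W => TangentSpace (𝓡∂ (2 * k + 2)) x →L[ℝ]
              TangentSpace (𝓡∂ (2 * k + 2)) x) x (K x)) ∧
      ∀ p, K p ∈ convexTame ι Ω ξ α p := by
  obtain ⟨s, hs⟩ := exists_contMDiffSection_forall_mem_convex_of_local (𝓡∂ (2 * k + 2)) (n := ⊤)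
    (F_fiber := EuclideanSpace ℝ (Fin (2 * k + 2)) →L[ℝ] EuclideanSpace ℝ (Fin (2 * k + 2)))
    (fun p : W => TangentSpace (𝓡∂ (2 * k + 2)) p →L[ℝ] TangentSpace (𝓡∂ (2 * k + 2)) p)
    (convexTame ι Ω ξ α) (convex_convexTame ι Ω ξ α) (fun p => by
      by_cases hp : p ∈ range ι
      · obtain ⟨x, rfl⟩ := hp
        obtain ⟨s, U, hU, hs, hst, hsc⟩ := h.exists_localSection hι hΩ hα hα0 hαd x
        refine ⟨U, hU, s, hs, fun p hp => ⟨hst p hp, ?_⟩⟩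
        rintro x rfl
        exact hsc x hp
      · obtain ⟨s, U, hU, hs, hst⟩ := hΩ.exists_localSection p
        -- Away from the closed set `ι(V)` the contact condition is vacuous.
        have hr : IsClosed (range ι) :=
          (isCompact_range hι.isSmoothEmbedding.contMDiff.continuous).isClosed
        refine ⟨U ∩ (range ι)ᶜ, Filter.inter_mem hU (hr.isOpen_compl.mem_nhds hp), s,
          hs.mono inter_subset_left, fun p hp => ⟨hst p hp.1, ?_⟩⟩
        rintro x rfl
        exact absurd ⟨x, rfl⟩ hp.2)
  exact ⟨s, s.contMDiff, hs⟩

/-- `J` is the pointwise rotation average of the glued field `K`: tameness and invariance survive,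
`J² = -1` is gained, and `Ω` itself serves as the taming symplectic form. -/
lemma IsWeakFilling.exists_isTamedPseudoconvexBoundary {ι : V → W}
    (hι : IsBoundaryIdentification (k := k) ι) {Ω : DForm (𝓡∂ (2 * k + 2)) W 2}
    (hΩ : IsSymplecticForm Ω) {ξ : ContactStructure k V} (h : IsWeakFilling ι Ω ξ) :
    ∃ J : ∀ p : W, TangentSpace (𝓡∂ (2 * k + 2)) p →L[ℝ] TangentSpace (𝓡∂ (2 * k + 2)) p,
      IsAlmostComplexStructure J ∧ IsTamedBy J Ω ∧ IsTamedPseudoconvexBoundary ι J ξ := by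
  obtain ⟨α, hαs, hα0, hαp, hαo, hαd⟩ := ξ.exists_form
  have hα : ξ.IsContactForm α := ⟨hαs, hαp, hαo⟩
  obtain ⟨K, hKs, hK⟩ := h.exists_convexTame hι hΩ hα hα0 hαd
  let E := EuclideanSpace ℝ (Fin (2 * k + 2))
  have hKr : ∀ p, IsRotatable (A := E →L[ℝ] E) (K p) := fun p =>
    isRotatable_of_tame (isAlt_altBilin (T := E) (Ω p)) (hK p).1
  let J : ∀ p : W, TangentSpace (𝓡∂ (2 * k + 2)) p →L[ℝ] TangentSpace (𝓡∂ (2 * k + 2)) p :=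
    fun p => rotAvg (A := E →L[ℝ] E) (K p)
  have hJ : ∀ p v, J p (J p v) = -v := fun p v =>
    DFunLike.congr_fun (rotAvg_mul_self (hKr p)) v
  have hJΩ : IsTamedBy J Ω := fun p v hv =>
    rotAvg_tame (hKr p) (S := ⊤) (fun _ _ => trivial) (isAlt_altBilin (T := E) (Ω p))
      (fun v _ hv => (hK p).1 v hv) trivial hv
  have hJc : ∀ x, IsConvexAt ι ξ α x (J (ι x)) := fun x =>
    rotAvg_exists_pos (E := E) (F := EuclideanSpace ℝ (Fin (2 * k + 1))) (hKr (ι x))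
      (L := mfderiv (𝓡 (2 * k + 1)) (𝓡∂ (2 * k + 2)) ι x) (hι.mfderiv_injective x)
      (δ := α.d x) ((hK (ι x)).2 x rfl)
  refine ⟨J, ⟨contMDiff_rotAvg_section hKs hKr, hJ⟩, hJΩ,
    (isOrientedBoundary_iff hJ hJΩ).2 h.oriented, fun x => ?_, ⟨Ω, hΩ, hJΩ⟩,
    fun l hl x v hv hv0 => ?_⟩
  · refine map_eq_range_inf_map (hJ (ι x)) (a := (oneForm (E := EuclideanSpace ℝ (Fin (2 * k + 1)))
      (α x)).toLinearMap) (fun v => ?_) fun v hv => ?_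
    · refine (hαp x v).trans (Eq.congr_left ?_)
      exact (oneForm_apply (E := EuclideanSpace ℝ (Fin (2 * k + 1))) (α x) v).symm
    · obtain rfl | hv0 := eq_or_ne v 0
      · exact ⟨0, zero_mem _, by simp⟩
      · obtain ⟨w, hw, hwJ, -⟩ := hJc x v hv hv0
        exact ⟨w, hw, hwJ⟩
  · obtain ⟨w, hw, hwJ, hp⟩ := hJc x v hv hv0
    -- The field is only known to be convex for the chosen `α`; any other contact form has a
    -- positive multiple of `dα` on `ξ`.
    obtain ⟨c, hc, hd⟩ := hα.exists_d_eq hα0 hl x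
    refine ⟨w, hw, hwJ, ?_⟩
    rw [hd v hv w hw]
    exact mul_pos hc hp

end Assembly

end

theorem theoremD (k : ℕ) (hk : 1 ≤ k)
    {V : Type*} [TopologicalSpace V] [T2Space V] [CompactSpace V]
    [ChartedSpace (EuclideanSpace ℝ (Fin (2 * k + 1))) V] [IsManifold (𝓡 (2 * k + 1)) ∞ V]
    {W : Type*} [TopologicalSpace W] [T2Space W] [CompactSpace W]
    [ChartedSpace (EuclideanHalfSpace (2 * k + 2)) W] [IsManifold (𝓡∂ (2 * k + 2)) ∞ W]
    (ι : V → W) (hι : IsBoundaryIdentification (k := k) ι)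
    (Ω : DForm (𝓡∂ (2 * k + 2)) W 2) (hΩ : IsSymplecticForm Ω)
    (ξ : ContactStructure k V) :
    IsWeakFilling ι Ω ξ ↔
      ∃ J : ∀ p : W, TangentSpace (𝓡∂ (2 * k + 2)) p →L[ℝ] TangentSpace (𝓡∂ (2 * k + 2)) p,
        IsAlmostComplexStructure J ∧ IsTamedBy J Ω ∧ IsTamedPseudoconvexBoundary ι J ξ :=
  ⟨fun h => h.exists_isTamedPseudoconvexBoundary hι hΩ,
    fun ⟨_, hJ, hJΩ, hJξ⟩ => hJξ.isWeakFilling hι hJ.sq_eq_neg hJΩ⟩
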